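/- **Setting.** Latin indices run over $x,y,z$, Greek indices over $x,y$, repeated indices are summed, $\epsilon_{ijk}$ and $\epsilon_{\alpha\beta}=\epsilon_{\alpha\beta z}$ are the permutation symbols. Let $\Omega\subset\mathbb{R}^3$ be open, let $\mathcal{L}$ be a set of isolated lines parallel to the $z$-axis, $L\in\mathcal L$ having planar position $x^L=(x^L_\alpha)$, such that $\Omega_L:=\Omega\setminus\bigcup\mathcal{L}$ is open; isolated means that each $L$ is crossed at some point by a closed horizontal disc of positive radius centred on $L$, contained in $\Omega$ and meeting no other line of $\mathcal L$. Let $C_L$ be the boundary circle of any such disc, run through once counterclockwise. Let $x_0$ be a fixed reference point. Let $\mathcal{E}^\star_{ij}$ be a strain tensor, locally integrable on $\Omega$ (for instance $L^1(\Omega)$), which on $\Omega_L$ is symmetric, independent of $z$ (a function of $x_\alpha$ only), $C^\infty$ and compatible, that is, for some real constants $K,a_\alpha,b$, $$\epsilon_{\alpha\gamma}\epsilon_{\beta\delta}\partial_\alpha\partial_\beta\mathcal{E}^\star_{\gamma\delta}=0,\qquad \epsilon_{\alpha\beta}\partial_\alpha\mathcal{E}^\star_{\beta z}=K,\qquad \mathcal{E}^\star_{zz}=a_\alpha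 x_\alpha+b\qquad\text{on }\Omega_L .$$ Assume moreover that the distributions $\partial_\alpha\mathcal{E}^\star_{\alpha i}$ and $\partial_\gamma\mathcal{E}^\star_{\kappa\kappa}$ on $\Omega$ are (signed) Radon measures, finite on compact subsets of $\Omega$. **Definitions.** The Frank tensor is the distribution $\overline\partial_m\omega^\star_k:=\epsilon_{kpq}\partial_p\mathcal{E}^\star_{qm}$ on $\Omega$; it is a smooth function on $\Omega_L$, and there $\overline\partial_l b^\star_k:=\mathcal{E}^\star_{kl}+\epsilon_{kpq}(x_p-x_{0p})\overline\partial_l\omega^\star_q$. The Frank and Burgers vectors of $L\in\mathcal{L}$ are the jumps $$\Omega^{\star L}_k:=\int_{C_L}\overline\partial_m\omega^\star_k\,d\xi_m,\qquad B^{\star L}_k:=\int_{C_L}\overline\partial_l b^\star_k\,d\xi_l .$$ With $\delta_L$ the one-dimensional Hausdorff measure concentrated on $L$, the disclination density, dislocation density, displacement jump density and contortion are the distributions on $\Omega$ $$\Theta^\star_k:=\sum_{L}\delta_{kz}\Omega^{\star L}_z\delta_L,\qquad \Lambda^\star_k:=\sum_L B^{\star L}_k\delta_L,$$ $$\alpha^\star_k:=\Lambda^\star_k-\delta_{k\alpha}\epsilon_{\alpha\beta}\Theta^\star_z(x_\beta-x_{0\beta}),\qquad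 \kappa^\star_{ij}:=\delta_{iz}\alpha^\star_j-\tfrac12\alpha^\star_z\delta_{ij}.$$ Finally put $$\eth_\beta\omega^\star_k:=\overline\partial_\beta\omega^\star_k-\kappa^\star_{k\beta},\qquad \eth_\alpha\eth_\beta u^\star_k:=\partial_\alpha\mathcal{E}^\star_{k\beta}+\epsilon_{kp\beta}\,\eth_\alpha\omega^\star_p .$$ **Theorem.** For $k=x,y,z$, as distributions on $\Omega$, $$\epsilon_{\alpha\beta}\,\partial_\alpha\eth_\beta\omega^\star_k=\Theta^\star_k\qquad\text{and}\qquad \epsilon_{\alpha\beta}\,\eth_\alpha\eth_\beta u^\star_k=\alpha^\star_k .$$ -/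

import Mathlib

open MeasureTheory TopologicalSpace
open scoped Distributions

noncomputable section

namespace Dislocation

/-- Three-dimensional Euclidean space; the coordinates `0, 1, 2` are `x, y, z`. -/
abbrev R3 := EuclideanSpace ℝ (Fin 3)

/-- The plane of the coordinates `x, y`. -/
abbrev R2 := EuclideanSpace ℝ (Fin 2)

/-- The Cartesian basis vector `e_i`. -/
def e (i : Fin 3) : R3 := EuclideanSpace.single i 1

/-- A Greek (planar) index `0, 1` seen as a Latin index. -/
def lat (α : Fin 2) : Fin 3 := α.castSucc

/-- Kronecker's symbol. -/
def kron (i j : Fin 3) : ℝ := if i = j then 1 else 0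

/-- The permutation symbol in three dimensions, with `ε_{xyz} = 1`. -/
def eps3 (i j k : Fin 3) : ℝ :=
  if (i, j, k) = (0, 1, 2) ∨ (i, j, k) = (1, 2, 0) ∨ (i, j, k) = (2, 0, 1) then 1
  else if (i, j, k) = (0, 2, 1) ∨ (i, j, k) = (2, 1, 0) ∨ (i, j, k) = (1, 0, 2) then -1
  else 0

/-- The permutation symbol in two dimensions, with `ε_{xy} = 1`. -/
def eps2 (α β : Fin 2) : ℝ := eps3 (lat α) (lat β) 2

/-- The projection `(x, y, z) ↦ (x, y)`. -/
def planar (x : R3) : R2 := !₂[x 0, x 1]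

/-- The point of planar coordinates `p` at height `z`. -/
def lift (p : R2) (z : ℝ) : R3 := !₂[p 0, p 1, z]

/-- The union of the lines parallel to the `z`-axis located at the positions `p ∈ P`. -/
def lines (P : Set R2) : Set R3 := {x | planar x ∈ P}

/-- The domain without the defect lines. -/
def regularPart (Ω : Opens R3) (P : Set R2) : Set R3 := (Ω : Set R3) \ lines P

/-! ### Pointwise fields on the regular part of the domain -/

/-- The classical partial derivative. -/
def pd (i : Fin 3) (f : R3 → ℝ) (x : R3) : ℝ := fderiv ℝ f x (e i)

/-- The smooth field `∂̄_m ω_k = ε_{kpq} ∂_p E_{qm}` on the regular part. -/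
def frankField (E : Fin 3 → Fin 3 → R3 → ℝ) (m k : Fin 3) (x : R3) : ℝ :=
  ∑ p, ∑ q, eps3 k p q * pd p (E q m) x

/-- The smooth field `∂̄_l b_k = E_{kl} + ε_{kpq} (x_p - x_{0p}) ∂̄_l ω_q` on the regular part. -/
def burgersField (E : Fin 3 → Fin 3 → R3 → ℝ) (x₀ : R3) (l k : Fin 3) (x : R3) : ℝ :=
  E k l x + ∑ p, ∑ q, eps3 k p q * (x p - x₀ p) * frankField E l q x

/-- The horizontal circle at height `z`, centred on the line at `p`, of radius `r`, run through
once counterclockwise for `t` from `0` to `2π`. -/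
def circleLoop (p : R2) (z r : ℝ) (t : ℝ) : R3 :=
  !₂[p 0 + r * Real.cos t, p 1 + r * Real.sin t, z]

/-- The integral `∫_C w_m dξ_m` along a loop parametrized by `[0, 2π]`. -/
def loopIntegral (w : Fin 3 → R3 → ℝ) (γ : ℝ → R3) : ℝ :=
  ∫ t in (0 : ℝ)..(2 * Real.pi), ∑ m, w m (γ t) * deriv (fun s => γ s m) t

/-- The circle of radius `r` at height `z` bounds a flat disc in `Ω` that meets the defect lines
in its centre, on the line at `p`, and nowhere else. -/
def Encircles (Ω : Opens R3) (P : Set R2) (p : R2) (z r : ℝ) : Prop :=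
  0 < r ∧ ∀ q : R2, dist q p ≤ r → lift q z ∈ Ω ∧ (q ∈ P → q = p)

/-- A choice, for each position of a line, of a circle around it. -/
structure Loops where
  height : R2 → ℝ
  radius : R2 → ℝ

/-- The Frank vector of the line at `p`: the jump `[ω_k] = ∫_C ∂̄_m ω_k dξ_m`. -/
def frankVector (E : Fin 3 → Fin 3 → R3 → ℝ) (C : Loops) (k : Fin 3) (p : R2) : ℝ :=
  loopIntegral (fun m => frankField E m k) (circleLoop p (C.height p) (C.radius p))

/-- The Burgers vector of the line at `p`: the jump `[b_k] = ∫_C ∂̄_l b_k dξ_l`. -/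
def burgersVector (E : Fin 3 → Fin 3 → R3 → ℝ) (x₀ : R3) (C : Loops) (k : Fin 3) (p : R2) : ℝ :=
  loopIntegral (fun l => burgersField E x₀ l k) (circleLoop p (C.height p) (C.radius p))

/-! ### Distributions on the whole domain -/

section Distributions

variable (Ω : Opens R3)

/-- The distribution `φ ↦ ∫ φ f dμ`, where `f` is locally `μ`-integrable on `Ω`. -/
def ofDensity (μ : Measure R3) (f : R3 → ℝ) : 𝓓'(Ω, ℝ) :=
  (TestFunction.integralAgainstBilinCLM (ContinuousLinearMap.mul ℝ ℝ) μ f :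
    𝓓(Ω, ℝ) →L[ℝ] ℝ)

/-- The distribution of a locally integrable function on `Ω`. -/
def ofFun (f : R3 → ℝ) : 𝓓'(Ω, ℝ) := ofDensity Ω volume f

variable {Ω} in
/-- The distributional partial derivative `∂_i T`, `⟨∂_i T, φ⟩ = -⟨T, ∂_i φ⟩`. -/
def dpd (i : Fin 3) (T : 𝓓'(Ω, ℝ)) : 𝓓'(Ω, ℝ) := LineDeriv.lineDerivOp (e i) T

variable {Ω} in
/-- The distribution `T` on `Ω` is a Radon measure: it is the difference of two positive measures,
both finite on the compact subsets of `Ω`. -/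
def IsRadon (T : 𝓓'(Ω, ℝ)) : Prop :=
  ∃ μ ν : Measure R3,
    (∀ K : Set R3, IsCompact K → K ⊆ Ω → μ K < ⊤ ∧ ν K < ⊤) ∧
    ∀ φ : 𝓓(Ω, ℝ), T φ = ∫ x, φ x ∂μ - ∫ x, φ x ∂ν

variable (P : Set R2) (E : Fin 3 → Fin 3 → R3 → ℝ) (x₀ : R3) (C : Loops)

/-- The sum over the lines `L` of `c δ_L`, where `δ_L` is the one-dimensional Hausdorff measure
concentrated on `L`. The lines are disjoint, so this is the density `c` on their union. -/
def onLines (c : R3 → ℝ) : 𝓓'(Ω, ℝ) :=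
  ofDensity Ω ((Measure.hausdorffMeasure 1 : Measure R3).restrict (lines P)) c

/-- The disclination density `Θ_k = ∑_L δ_{kz} Ω_z^L δ_L`. -/
def disclinationDensity (k : Fin 3) : 𝓓'(Ω, ℝ) :=
  onLines Ω P fun x => kron k 2 * frankVector E C 2 (planar x)

/-- The dislocation density `Λ_k = ∑_L B_k^L δ_L`. -/
def dislocationDensity (k : Fin 3) : 𝓓'(Ω, ℝ) :=
  onLines Ω P fun x => burgersVector E x₀ C k (planar x)

/-- The displacement jump density
`α_k = Λ_k - δ_{kα} ε_{αβ} Θ_z (x_β - x_{0β})`. -/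
def jumpDensity (k : Fin 3) : 𝓓'(Ω, ℝ) :=
  dislocationDensity Ω P E x₀ C k -
    ∑ α : Fin 2, ∑ β : Fin 2, (kron k (lat α) * eps2 α β) •
      onLines Ω P fun x => frankVector E C 2 (planar x) * (x (lat β) - x₀ (lat β))

/-- The contortion `κ_{ij} = δ_{iz} α_j - (1/2) α_z δ_{ij}`. -/
def contortion (i j : Fin 3) : 𝓓'(Ω, ℝ) :=
  kron i 2 • jumpDensity Ω P E x₀ C j - ((1 / 2 : ℝ) * kron i j) • jumpDensity Ω P E x₀ C 2

/-- The Frank tensor `∂̄_m ω_k = ε_{kpq} ∂_p E_{qm}` as a distribution on `Ω`. -/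
def frankTensor (m k : Fin 3) : 𝓓'(Ω, ℝ) :=
  ∑ p, ∑ q, eps3 k p q • dpd p (ofFun Ω (E q m))

/-- `ð_β ω_k = ∂̄_β ω_k - κ_{kβ}`. -/
def ethRotation (β : Fin 2) (k : Fin 3) : 𝓓'(Ω, ℝ) :=
  frankTensor Ω E (lat β) k - contortion Ω P E x₀ C k (lat β)

/-- `ð_α ð_β u_k = ∂_α E_{kβ} + ε_{kpβ} ð_α ω_p`. -/
def ethEthDisplacement (α β : Fin 2) (k : Fin 3) : 𝓓'(Ω, ℝ) :=
  dpd (lat α) (ofFun Ω (E k (lat β))) +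
    ∑ p, eps3 k p (lat β) • ethRotation Ω P E x₀ C α p

/-- The assumptions on the strain `E` of a body `Ω` with defect lines at the positions `P`. -/
structure IsStrain : Prop where
  /-- symmetry -/
  symm : ∀ i j, ∀ x ∈ regularPart Ω P, E i j x = E j i x
  /-- independence of the vertical coordinate -/
  vertical : ∀ i j, ∀ x ∈ regularPart Ω P, ∀ y ∈ regularPart Ω P,
    planar x = planar y → E i j x = E i j y
  /-- smoothness away from the lines -/
  smooth : ∀ i j, ContDiffOn ℝ ((⊤ : ℕ∞) : WithTop ℕ∞) (E i j) (regularPart Ω P)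
  /-- integrability across the lines -/
  integrable : ∀ i j, LocallyIntegrableOn (E i j) Ω volume
  /-- compatibility away from the lines -/
  compatible : ∃ (K : ℝ) (a : Fin 2 → ℝ) (b : ℝ), ∀ x ∈ regularPart Ω P,
    (∑ α : Fin 2, ∑ β : Fin 2, ∑ γ : Fin 2, ∑ δ : Fin 2,
      eps2 α γ * eps2 β δ * pd (lat α) (pd (lat β) (E (lat γ) (lat δ))) x = 0) ∧
    (∑ α : Fin 2, ∑ β : Fin 2, eps2 α β * pd (lat α) (E (lat β) 2) x = K) ∧
    E 2 2 x = ∑ α : Fin 2, a α * x (lat α) + b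
  /-- the strain divergence `∂_α E_{αi}` is a Radon measure on `Ω` -/
  radon_div : ∀ i, IsRadon (∑ α : Fin 2, dpd (lat α) (ofFun Ω (E (lat α) i)))
  /-- the gradient `∂_γ E_{κκ}` of the planar trace is a Radon measure on `Ω` -/
  radon_trace : ∀ γ : Fin 2,
    IsRadon (∑ κ : Fin 2, dpd (lat γ) (ofFun Ω (E (lat κ) (lat κ))))

end Distributions

end Dislocation

end

/-! The identities are local (`distribution_eq_zero_of_local`), so it suffices to use test functions
supported in a small vertical cylinder that meets at most one line (`exists_isCylinder`). There the
strain does not depend on `z`: off a null set it equals its slice at the height of the circle chosen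
for that line. Fubini then turns each pairing into a planar integral followed by an integral in `z`,
and vertical derivatives drop out.

In the plane, the question is which distribution concentrated at one point `p` is the curl, or the
incompatibility, of an integrable field that satisfies the homogeneous equation off `p`.
Integrability bounds its order. Replace the test function `g` near `p`, at scale `ε`, by its Taylor
polynomial of degree 0 for the curl and 1 for the incompatibility. The discarded remainder vanishes
at `p` to the order of the operator, so cutting it off costs derivatives of that order that are
bounded uniformly in `ε`. Dominated convergence lets `ε` tend to 0, while Green's formula evaluates
each modified integral as the same loop integral. Hence the curl is a multiple of `δ_p`
(`integral_curl`), and the incompatibility is a combination of `δ_p` and its first derivatives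
(`integral_incompatibility`). The coefficients are the circulation of the rotation gradient
(`frankJump`) and its two first moments (`momentX`, `momentY`); for the curl of the shear strain,
corrected by `K`, the coefficient is `shearJump`.

These coefficients are the Frank and Burgers vectors in disguise. Moving the base point of the
Burgers vector from `x₀` to the line, which is what the `Θ` term in the definition of `α` does,
gives on the line `α_x = momentY`, `α_y = -momentX` and `α_z = 2 shearJump` (`burgersVector_eq`). So
the incompatibility of the planar strain is `Θ_z + ε_{αβ} ∂_α α_β`, and the curl of the shear is `K
+ α_z / 2`. The curl of the contortion removes exactly the terms in `α`, and `K` disappears under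
one more derivative. This is the first identity.

The second identity involves no jump: the derivatives of the strain cancel by symmetry and
independence of `z`, and contracting the contortion with the permutation symbols returns `α`
(`displacement_apply`). -/

noncomputable section

namespace Dislocation

/-! ### Calculus of directional derivatives. -/

section DirectionalDerivative

variable {V : Type*} [NormedAddCommGroup V] [NormedSpace ℝ V]

/-- The derivative of a real function in the direction `a`. -/
def dd (a : V) (f : V → ℝ) (x : V) : ℝ := fderiv ℝ f x a

lemma dd_add {a : V} {f g : V → ℝ} {x : V} (hf : DifferentiableAt ℝ f x)
    (hg : DifferentiableAt ℝ g x) : dd a (fun y => f y + g y) x = dd a f x + dd a g x := by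
  simp [dd, fderiv_fun_add hf hg]

lemma dd_sub {a : V} {f g : V → ℝ} {x : V} (hf : DifferentiableAt ℝ f x)
    (hg : DifferentiableAt ℝ g x) : dd a (fun y => f y - g y) x = dd a f x - dd a g x := by
  simp [dd, fderiv_fun_sub hf hg]

lemma dd_mul {a : V} {f g : V → ℝ} {x : V} (hf : DifferentiableAt ℝ f x)
    (hg : DifferentiableAt ℝ g x) :
    dd a (fun y => f y * g y) x = dd a f x * g x + f x * dd a g x := by
  simp [dd, fderiv_fun_mul hf hg]; ring

lemma dd_const (a : V) (c : ℝ) (x : V) : dd a (fun _ => c) x = 0 := by simp [dd]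

lemma dd_congr {a : V} {f g : V → ℝ} {x : V} (h : f =ᶠ[nhds x] g) : dd a f x = dd a g x := by
  simp [dd, h.fderiv_eq]

lemma dd_eventuallyEq {a : V} {f g : V → ℝ} {x : V} (h : f =ᶠ[nhds x] g) :
    dd a f =ᶠ[nhds x] dd a g := by
  filter_upwards [h.eventuallyEq_nhds] with y hy using dd_congr hy

lemma contDiff_dd {n m : WithTop ℕ∞} {f : V → ℝ} (hf : ContDiff ℝ n f) (h : m + 1 ≤ n) (a : V) :
    ContDiff ℝ m (dd a f) :=
  (hf.fderiv_right h).clm_apply contDiff_const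

lemma contDiffAt_dd {n m : WithTop ℕ∞} {f : V → ℝ} {x : V} (hf : ContDiffAt ℝ n f x)
    (h : m + 1 ≤ n) (a : V) : ContDiffAt ℝ m (dd a f) x :=
  (hf.fderiv_right h).clm_apply contDiffAt_const

lemma dd_dd_eq {f : V → ℝ} {x : V} (hf : ContDiffAt ℝ 2 f x) (a b : V) :
    dd a (dd b f) x = fderiv ℝ (fderiv ℝ f) x a b := by
  have h1 : DifferentiableAt ℝ (fderiv ℝ f) x :=
    (hf.fderiv_right (m := 1) (by norm_num)).differentiableAt (by norm_num)
  change fderiv ℝ (fun y => fderiv ℝ f y b) x a = _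
  rw [fderiv_clm_apply h1 (by fun_prop)]
  simp

lemma dd_comm {f : V → ℝ} {x : V} (hf : ContDiffAt ℝ 2 f x) (a b : V) :
    dd a (dd b f) x = dd b (dd a f) x := by
  rw [dd_dd_eq hf, dd_dd_eq hf]
  exact (hf.isSymmSndFDerivAt (by simp)) a b

lemma tsupport_dd_subset (a : V) (f : V → ℝ) : tsupport (dd a f) ⊆ tsupport f :=
  tsupport_fderiv_apply_subset ℝ a

lemma dd_eq_zero_of_notMem_tsupport {a : V} {f : V → ℝ} {x : V} (hx : x ∉ tsupport f) :
    dd a f x = 0 :=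
  image_eq_zero_of_notMem_tsupport fun h => hx (tsupport_dd_subset a f h)

/-- The product of a smooth function with a function that is smooth near its support. -/
lemma contDiffAt_mul_of_tsupport {n : WithTop ℕ∞} {f g : V → ℝ} {x : V} (hf : ContDiffAt ℝ n f x)
    (hg : x ∈ tsupport f → ContDiffAt ℝ n g x) : ContDiffAt ℝ n (fun y => f y * g y) x := by
  by_cases hx : x ∈ tsupport f
  · exact hf.mul (hg hx)
  · have : (fun y => f y * g y) =ᶠ[nhds x] fun _ => 0 := by
      filter_upwards [notMem_tsupport_iff_eventuallyEq.1 hx] with y hy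
      simp [hy]
    exact contDiffAt_const.congr_of_eventuallyEq this

end DirectionalDerivative

/-! ### Green's theorem and integration in polar coordinates on a disc. -/

section Green

open Real

/-- The point of polar coordinates `(r, t)` around `p`. -/
def circ (p : ℝ × ℝ) (r t : ℝ) : ℝ × ℝ := (p.1 + r * cos t, p.2 + r * sin t)

/-- The closed Euclidean disc in the coordinate plane. -/
def disc (p : ℝ × ℝ) (r : ℝ) : Set (ℝ × ℝ) := {q | (q.1 - p.1) ^ 2 + (q.2 - p.2) ^ 2 ≤ r ^ 2}

/-- The integral of `a dx + b dy` along the circle of centre `p` and radius `r`. -/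
def loop (p : ℝ × ℝ) (r : ℝ) (a b : ℝ × ℝ → ℝ) : ℝ :=
  ∫ t in (0 : ℝ)..(2 * π), (a (circ p r t) * (-(r * sin t)) + b (circ p r t) * (r * cos t))

lemma circ_mem_disc (p : ℝ × ℝ) {r s : ℝ} (h0 : 0 ≤ s) (hs : s ≤ r) (t : ℝ) :
    circ p s t ∈ disc p r := by
  have : (s * cos t) ^ 2 + (s * sin t) ^ 2 = s ^ 2 := by
    rw [mul_pow, mul_pow, ← mul_add, cos_sq_add_sin_sq, mul_one]
  simp only [disc, circ, Set.mem_ofPred_eq, add_sub_cancel_left, this]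
  gcongr

lemma continuous_circ (p : ℝ × ℝ) : Continuous fun x : ℝ × ℝ => circ p x.1 x.2 := by
  unfold circ; fun_prop

lemma hasFDerivAt_circ (p x : ℝ × ℝ) :
    HasFDerivAt (fun x : ℝ × ℝ => circ p x.1 x.2)
      (((cos x.2 • ContinuousLinearMap.fst ℝ ℝ ℝ -
          (x.1 * sin x.2) • ContinuousLinearMap.snd ℝ ℝ ℝ)).prod
        ((sin x.2 • ContinuousLinearMap.fst ℝ ℝ ℝ +
          (x.1 * cos x.2) • ContinuousLinearMap.snd ℝ ℝ ℝ))) x := by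
  have h1 : HasFDerivAt (fun x : ℝ × ℝ => x.1) (ContinuousLinearMap.fst ℝ ℝ ℝ) x :=
    hasFDerivAt_fst
  have h2 : HasFDerivAt (fun x : ℝ × ℝ => x.2) (ContinuousLinearMap.snd ℝ ℝ ℝ) x :=
    hasFDerivAt_snd
  have := ((h1.mul h2.cos).const_add p.1).prodMk ((h1.mul h2.sin).const_add p.2)
  refine this.congr_fderiv ?_
  ext <;> simp

lemma fderiv_apply_prod (f : ℝ × ℝ → ℝ) (q : ℝ × ℝ) (u v : ℝ) :
    fderiv ℝ f q (u, v) = u * dd (1, 0) f q + v * dd (0, 1) f q := by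
  have : ((u, v) : ℝ × ℝ) = u • ((1, 0) : ℝ × ℝ) + v • ((0, 1) : ℝ × ℝ) := by ext <;> simp
  rw [this, map_add, map_smul, map_smul]; rfl

/-- **Green's theorem** on a disc, in polar coordinates. -/
theorem loop_eq_integral_polar {p : ℝ × ℝ} {r : ℝ} (hr : 0 ≤ r) {a b : ℝ × ℝ → ℝ}
    (ha : ∀ q ∈ disc p r, ContDiffAt ℝ 1 a q) (hb : ∀ q ∈ disc p r, ContDiffAt ℝ 1 b q) :
    loop p r a b = ∫ s in (0 : ℝ)..r, ∫ t in (0 : ℝ)..(2 * π),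
      s * (dd (1, 0) b (circ p s t) - dd (0, 1) a (circ p s t)) := by
  -- Pulled back by polar coordinates, `a dx + b dy` becomes `-g ds + f dt`, so the divergence of
  -- `(f, g)` is `s` times the curl. The divergence theorem on the rectangle `[0, r] × [0, 2π]` then
  -- replaces Green's theorem on the disc.
  set f : ℝ × ℝ → ℝ := fun x =>
    x.1 * (b (circ p x.1 x.2) * cos x.2 - a (circ p x.1 x.2) * sin x.2) with hf
  set g : ℝ × ℝ → ℝ := fun x =>
    -(a (circ p x.1 x.2) * cos x.2 + b (circ p x.1 x.2) * sin x.2) with hg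
  have hmem : ∀ x ∈ Set.uIcc 0 r ×ˢ Set.uIcc 0 (2 * π), circ p x.1 x.2 ∈ disc p r := by
    rintro ⟨s, t⟩ ⟨hs, -⟩
    rw [Set.uIcc_of_le hr] at hs
    exact circ_mem_disc p hs.1 hs.2 t
  have hc : ∀ {c : ℝ × ℝ → ℝ}, (∀ q ∈ disc p r, ContDiffAt ℝ 1 c q) →
      ∀ x ∈ Set.uIcc 0 r ×ˢ Set.uIcc 0 (2 * π),
        DifferentiableAt ℝ (fun x : ℝ × ℝ => c (circ p x.1 x.2)) x ∧
        ∀ u v, fderiv ℝ (fun x : ℝ × ℝ => c (circ p x.1 x.2)) x (u, v) =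
          (cos x.2 * u - x.1 * sin x.2 * v) * dd (1, 0) c (circ p x.1 x.2) +
          (sin x.2 * u + x.1 * cos x.2 * v) * dd (0, 1) c (circ p x.1 x.2) := by
    intro c hc x hx
    have h1 := ((hc _ (hmem x hx)).differentiableAt (by norm_num)).hasFDerivAt.comp x
      (hasFDerivAt_circ p x)
    refine ⟨h1.differentiableAt, fun u v => ?_⟩
    have h2 : fderiv ℝ (fun x : ℝ × ℝ => c (circ p x.1 x.2)) x = _ := h1.fderiv
    rw [h2]
    simp [fderiv_apply_prod]
  have hdf : ∀ x ∈ Set.uIcc 0 r ×ˢ Set.uIcc 0 (2 * π), DifferentiableAt ℝ f x := by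
    intro x hx
    have h1 := (hc ha x hx).1
    have h2 := (hc hb x hx).1
    exact differentiableAt_fst.mul ((h2.mul differentiableAt_snd.cos).sub
      (h1.mul differentiableAt_snd.sin))
  have hdg : ∀ x ∈ Set.uIcc 0 r ×ˢ Set.uIcc 0 (2 * π), DifferentiableAt ℝ g x := by
    intro x hx
    have h1 := (hc ha x hx).1
    have h2 := (hc hb x hx).1
    exact ((h1.mul differentiableAt_snd.cos).add (h2.mul differentiableAt_snd.sin)).neg
  have hdiv : ∀ x ∈ Set.uIcc 0 r ×ˢ Set.uIcc 0 (2 * π),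
      fderiv ℝ f x (1, 0) + fderiv ℝ g x (0, 1) =
        x.1 * (dd (1, 0) b (circ p x.1 x.2) - dd (0, 1) a (circ p x.1 x.2)) := by
    intro x hx
    obtain ⟨h1, h1'⟩ := hc ha x hx
    obtain ⟨h2, h2'⟩ := hc hb x hx
    have hcos : HasFDerivAt (fun x : ℝ × ℝ => cos x.2) _ x :=
      (hasFDerivAt_snd (𝕜 := ℝ) (p := x)).cos
    have hsin : HasFDerivAt (fun x : ℝ × ℝ => sin x.2) _ x :=
      (hasFDerivAt_snd (𝕜 := ℝ) (p := x)).sin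
    have hfst : HasFDerivAt (fun x : ℝ × ℝ => x.1) (ContinuousLinearMap.fst ℝ ℝ ℝ) x :=
      hasFDerivAt_fst
    have e1 : HasFDerivAt f _ x := hfst.mul
      ((h2.hasFDerivAt.mul hcos).sub (h1.hasFDerivAt.mul hsin))
    have e2 : HasFDerivAt g _ x := ((h1.hasFDerivAt.mul hcos).add (h2.hasFDerivAt.mul hsin)).neg
    rw [e1.fderiv, e2.fderiv]
    simp [h1', h2']
    have := cos_sq_add_sin_sq x.2
    linear_combination (x.1 * (dd (1, 0) b (circ p x.1 x.2) - dd (0, 1) a (circ p x.1 x.2))) * this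
  have hcont : ContinuousOn
      (fun x : ℝ × ℝ => x.1 * (dd (1, 0) b (circ p x.1 x.2) - dd (0, 1) a (circ p x.1 x.2)))
      (Set.uIcc 0 r ×ˢ Set.uIcc 0 (2 * π)) := by
    intro x hx
    have k : ∀ {c : ℝ × ℝ → ℝ}, (∀ q ∈ disc p r, ContDiffAt ℝ 1 c q) → ∀ v : ℝ × ℝ,
        ContinuousAt (fun x : ℝ × ℝ => dd v c (circ p x.1 x.2)) x := fun {c} hc v =>
      ContinuousAt.comp (g := dd v c) (f := fun x : ℝ × ℝ => circ p x.1 x.2)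
        (contDiffAt_dd (hc _ (hmem x hx)) (m := 0) (by norm_num) v).continuousAt
        (continuous_circ p).continuousAt
    exact (continuousAt_fst.mul ((k hb _).sub (k ha _))).continuousWithinAt
  have hsub : Set.Ioo (min 0 r) (max 0 r) ×ˢ Set.Ioo (min 0 (2 * π)) (max 0 (2 * π)) ⊆
      Set.uIcc 0 r ×ˢ Set.uIcc 0 (2 * π) :=
    Set.prod_mono Set.Ioo_subset_Icc_self Set.Ioo_subset_Icc_self
  have key := integral2_divergence_prod_of_hasFDerivAt f g (fderiv ℝ f) (fderiv ℝ g) 0 0 r (2 * π)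
    (fun x hx => (hdf x hx).continuousAt.continuousWithinAt)
    (fun x hx => (hdg x hx).continuousAt.continuousWithinAt)
    (fun x hx => (hdf x (hsub hx)).hasFDerivAt) (fun x hx => (hdg x (hsub hx)).hasFDerivAt)
    ((hcont.congr hdiv).integrableOn_compact (isCompact_uIcc.prod isCompact_uIcc))
  have hl : (∫ x in (0 : ℝ)..r, ∫ y in (0 : ℝ)..(2 * π),
      fderiv ℝ f (x, y) (1, 0) + fderiv ℝ g (x, y) (0, 1)) =
      ∫ s in (0 : ℝ)..r, ∫ t in (0 : ℝ)..(2 * π),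
        s * (dd (1, 0) b (circ p s t) - dd (0, 1) a (circ p s t)) :=
    intervalIntegral.integral_congr fun s hs =>
      intervalIntegral.integral_congr fun t ht => hdiv (s, t) ⟨hs, ht⟩
  rw [← hl, key]
  -- Of the four edges only `s = r` contributes: the edges `t = 0` and `t = 2π` cancel by
  -- periodicity, and `f` carries the factor `s`, which vanishes at the centre.
  have h1 : ∀ x, g (x, 2 * π) = g (x, 0) := by intro x; simp [hg, circ]
  have h2 : ∀ y, f (0, y) = 0 := by intro y; simp [hf]
  simp only [h1, h2, sub_self, intervalIntegral.integral_zero, zero_add, sub_zero, loop]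
  exact intervalIntegral.integral_congr fun t _ => by simp only [hf]; ring

lemma continuousOn_polar {p : ℝ × ℝ} {r : ℝ} {f : ℝ × ℝ → ℝ} (hf : ContinuousOn f (disc p r)) :
    ContinuousOn (fun x : ℝ × ℝ => x.1 * f (circ p x.1 x.2)) (Set.Icc 0 r ×ˢ Set.univ) :=
  continuous_fst.continuousOn.mul
    (hf.comp (continuous_circ p).continuousOn fun _ hx => circ_mem_disc p hx.1.1 hx.1.2 _)

/-- Integration in polar coordinates of a function that vanishes outside a disc. -/
theorem integral_eq_integral_polar {p : ℝ × ℝ} {r : ℝ} (hr : 0 ≤ r) {f : ℝ × ℝ → ℝ}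
    (hf : ContinuousOn f (disc p r))
    (h0 : ∀ q, r ^ 2 < (q.1 - p.1) ^ 2 + (q.2 - p.2) ^ 2 → f q = 0) :
    ∫ q, f q = ∫ s in (0 : ℝ)..r, ∫ t in (0 : ℝ)..(2 * π), s * f (circ p s t) := by
  have e1 : ∫ q, f q = ∫ q, f (p + q) := (integral_add_left_eq_self f p).symm
  rw [e1, ← integral_comp_polarCoord_symm]
  have e2 : ∀ x : ℝ × ℝ, x.1 • f (p + polarCoord.symm x) = x.1 * f (circ p x.1 x.2) := by
    intro x
    simp [polarCoord_symm_apply, circ]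
    left; congr 1
  simp_rw [e2]
  have hsub : Set.Ioc 0 r ×ˢ Set.Ioo (-π) π ⊆ polarCoord.target := by
    rw [polarCoord_target]
    exact Set.prod_mono (fun x hx => hx.1) le_rfl
  rw [setIntegral_eq_of_subset_of_forall_sdiff_eq_zero polarCoord.open_target.measurableSet hsub]
  · have hint : IntegrableOn (fun x : ℝ × ℝ => x.1 * f (circ p x.1 x.2))
        (Set.Ioc 0 r ×ˢ Set.Ioo (-π) π) := by
      refine IntegrableOn.mono_set (t := Set.Icc 0 r ×ˢ Set.Icc (-π) π) ?_
        (Set.prod_mono Set.Ioc_subset_Icc_self Set.Ioo_subset_Icc_self)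
      exact ((continuousOn_polar hf).mono (Set.prod_mono le_rfl (Set.subset_univ _))
        ).integrableOn_compact (isCompact_Icc.prod isCompact_Icc)
    rw [Measure.volume_eq_prod, setIntegral_prod _ hint, intervalIntegral.integral_of_le hr]
    refine setIntegral_congr_fun measurableSet_Ioc fun s _ => ?_
    -- Polar coordinates use angles in `(-π, π)` and the loops use `[0, 2π]`; periodicity exchanges
    -- the two intervals.
    have per : Function.Periodic (fun t => s * f (circ p s t)) (2 * π) := by
      intro t; simp [circ]
    have := per.intervalIntegral_add_eq (-π) 0
    rw [zero_add, show -π + 2 * π = π by ring] at this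
    rw [← this, intervalIntegral.integral_of_le (by linarith [pi_pos]),
      integral_Ioc_eq_integral_Ioo]
  · rintro ⟨s, t⟩ ⟨h1, h2⟩
    rw [polarCoord_target] at h1
    have hs : r < s := by
      by_contra h
      exact h2 ⟨⟨h1.1, not_lt.1 h⟩, h1.2⟩
    have : (s * cos t) ^ 2 + (s * sin t) ^ 2 = s ^ 2 := by
      rw [mul_pow, mul_pow, ← mul_add, cos_sq_add_sin_sq, mul_one]
    rw [h0, mul_zero]
    simp only [circ, add_sub_cancel_left, this]
    gcongr

end Green

/-! ### Green's formulas with a multiplier, and passage to the limit. -/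

section Planar

open Real Filter Topology

/-- The partial derivative `∂_x` in the plane. -/
notation "Dx" => dd ((1, 0) : ℝ × ℝ)

/-- The partial derivative `∂_y` in the plane. -/
notation "Dy" => dd ((0, 1) : ℝ × ℝ)

lemma dd_const_mul {V : Type*} [NormedAddCommGroup V] [NormedSpace ℝ V] (a : V) (c : ℝ)
    {f : V → ℝ} {x : V} (hf : DifferentiableAt ℝ f x) :
    dd a (fun y => c * f y) x = c * dd a f x := by
  rw [dd_mul (differentiableAt_const c) hf, dd_const]; ring

/-- Green's formula for the product of a one-form of constant curl and a function supported
where the one-form is smooth. -/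
lemma loop_mul_eq_integral_polar {p : ℝ × ℝ} {r K : ℝ} (hr : 0 ≤ r) {H a b : ℝ × ℝ → ℝ}
    (hH : ContDiff ℝ 1 H)
    (hreg : ∀ q ∈ disc p r, q ∈ tsupport H →
      ContDiffAt ℝ 1 a q ∧ ContDiffAt ℝ 1 b q ∧ Dx b q - Dy a q = K) :
    loop p r (fun q => H q * a q) (fun q => H q * b q) =
      ∫ s in (0 : ℝ)..r, ∫ t in (0 : ℝ)..(2 * π), s *
        (Dx H (circ p s t) * b (circ p s t) - Dy H (circ p s t) * a (circ p s t)
          + H (circ p s t) * K) := by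
  rw [loop_eq_integral_polar hr]
  · refine intervalIntegral.integral_congr fun s hs => intervalIntegral.integral_congr fun t _ => ?_
    rw [Set.uIcc_of_le hr] at hs
    have hq := circ_mem_disc p hs.1 hs.2 t
    generalize circ p s t = q at hq
    by_cases hs : q ∈ tsupport H
    · obtain ⟨h1, h2, h3⟩ := hreg q hq hs
      have hd := hH.differentiable (by norm_num) q
      rw [dd_mul hd (h2.differentiableAt (by norm_num)),
        dd_mul hd (h1.differentiableAt (by norm_num))]
      linear_combination s * H q * h3
    · have h0 : ∀ c : ℝ × ℝ → ℝ, (fun y => H y * c y) =ᶠ[𝓝 q] fun _ => 0 := fun c => by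
        filter_upwards [notMem_tsupport_iff_eventuallyEq.1 hs] with y hy
        simp [hy]
      simp [dd_congr (h0 a), dd_congr (h0 b), dd_const, dd_eq_zero_of_notMem_tsupport hs,
        image_eq_zero_of_notMem_tsupport hs]
  · exact fun q hq => contDiffAt_mul_of_tsupport hH.contDiffAt fun h => (hreg q hq h).1
  · exact fun q hq => contDiffAt_mul_of_tsupport hH.contDiffAt fun h => (hreg q hq h).2.1

/-- The symmetric planar tensor of components `A`, `B`, `D` is twice differentiable and compatible
at `q`. -/
def CompatibleAt (A B D : ℝ × ℝ → ℝ) (q : ℝ × ℝ) : Prop :=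
  ContDiffAt ℝ 2 A q ∧ ContDiffAt ℝ 2 B q ∧ ContDiffAt ℝ 2 D q ∧
    Dx (Dx D) q - 2 * Dx (Dy B) q + Dy (Dy A) q = 0

/-- Green's formula for the incompatibility operator. -/
lemma loop_incompatibility {p : ℝ × ℝ} {r : ℝ} (hr : 0 ≤ r) {H A B D : ℝ × ℝ → ℝ}
    (hH : ContDiff ℝ 2 H) (hreg : ∀ q ∈ disc p r, q ∈ tsupport H → CompatibleAt A B D q) :
    loop p r (fun q => H q * (Dx B q - Dy A q) - (Dx H q * B q - Dy H q * A q))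
        (fun q => H q * (Dx D q - Dy B q) - (Dx H q * D q - Dy H q * B q)) =
      ∫ s in (0 : ℝ)..r, ∫ t in (0 : ℝ)..(2 * π), s *
        -(Dx (Dx H) (circ p s t) * D (circ p s t) - 2 * Dx (Dy H) (circ p s t) * B (circ p s t)
          + Dy (Dy H) (circ p s t) * A (circ p s t)) := by
  have hH1 : ContDiff ℝ 1 H := hH.of_le (by norm_num)
  have hdH : ∀ v, ContDiff ℝ 1 (dd v H) := fun v => contDiff_dd hH (by norm_num) v
  have cd : ∀ {f : ℝ × ℝ → ℝ} {q}, ContDiffAt ℝ 2 f q → ∀ v, ContDiffAt ℝ 1 (dd v f) q :=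
    fun h v => contDiffAt_dd h (by norm_num) v
  have c1 : ∀ {f : ℝ × ℝ → ℝ} {q}, ContDiffAt ℝ 2 f q → ContDiffAt ℝ 1 f q :=
    fun h => h.of_le (by norm_num)
  have hsm : ∀ {v w : ℝ × ℝ} {F G : ℝ × ℝ → ℝ} {q}, q ∈ disc p r →
      (q ∈ tsupport H → ContDiffAt ℝ 2 F q ∧ ContDiffAt ℝ 2 G q) → ∀ {M : ℝ × ℝ → ℝ},
      (q ∈ tsupport H → ContDiffAt ℝ 1 M q) →
      ContDiffAt ℝ 1 (fun q => H q * M q - (dd v H q * F q - dd w H q * G q)) q := by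
    intro v w F G q _ h M hM
    exact (contDiffAt_mul_of_tsupport hH1.contDiffAt hM).sub
      ((contDiffAt_mul_of_tsupport (hdH v).contDiffAt fun h' =>
          c1 (h (tsupport_dd_subset _ _ h')).1).sub
        (contDiffAt_mul_of_tsupport (hdH w).contDiffAt fun h' =>
          c1 (h (tsupport_dd_subset _ _ h')).2))
  -- In the curl of this one-form all products of two first derivatives cancel. There remain `H`
  -- times the incompatibility of the tensor, which is zero, minus the second derivatives of `H`
  -- paired with the tensor.
  rw [loop_eq_integral_polar hr]
  · refine intervalIntegral.integral_congr fun s hs => intervalIntegral.integral_congr fun t _ => ?_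
    rw [Set.uIcc_of_le hr] at hs
    have hq := circ_mem_disc p hs.1 hs.2 t
    generalize circ p s t = q at hq
    congr 1
    by_cases hs : q ∈ tsupport H
    · obtain ⟨h1, h2, h3, h4⟩ := hreg q hq hs
      have df : ∀ {f : ℝ × ℝ → ℝ}, ContDiffAt ℝ 1 f q → DifferentiableAt ℝ f q :=
        fun h => h.differentiableAt (by norm_num)
      have dH : DifferentiableAt ℝ H q := df hH1.contDiffAt
      have ddH : ∀ v, DifferentiableAt ℝ (dd v H) q := fun v => df (hdH v).contDiffAt
      have key : ∀ (u v w : ℝ × ℝ) (F G M N : ℝ × ℝ → ℝ), DifferentiableAt ℝ F q →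
          DifferentiableAt ℝ G q → DifferentiableAt ℝ M q → DifferentiableAt ℝ N q →
          dd u (fun q => H q * (M q - N q) - (dd v H q * F q - dd w H q * G q)) q =
          (dd u H q * (M q - N q) + H q * (dd u M q - dd u N q)) -
          ((dd u (dd v H) q * F q + dd v H q * dd u F q) -
            (dd u (dd w H) q * G q + dd w H q * dd u G q)) := by
        intro u v w F G M N hF hG hM hN
        have hMN : DifferentiableAt ℝ (fun q => M q - N q) q := hM.sub hN
        have e1 : DifferentiableAt ℝ (fun q => H q * (M q - N q)) q := dH.mul hMN
        have e2 : DifferentiableAt ℝ (fun q => dd v H q * F q) q := (ddH v).mul hF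
        have e3 : DifferentiableAt ℝ (fun q => dd w H q * G q) q := (ddH w).mul hG
        have e4 : DifferentiableAt ℝ (fun q => dd v H q * F q - dd w H q * G q) q := e2.sub e3
        rw [dd_sub e1 e4, dd_mul dH hMN, dd_sub hM hN, dd_sub e2 e3, dd_mul (ddH v) hF,
          dd_mul (ddH w) hG]
      rw [key _ _ _ _ _ _ _ (df (c1 h3)) (df (c1 h2)) (df (cd h3 _)) (df (cd h2 _)),
        key _ _ _ _ _ _ _ (df (c1 h2)) (df (c1 h1)) (df (cd h2 _)) (df (cd h1 _)),
        dd_comm hH.contDiffAt (0, 1) (1, 0), dd_comm h2 (0, 1) (1, 0)]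
      linear_combination H q * h4
    · have h0 : ∀ (v w : ℝ × ℝ) (F G M : ℝ × ℝ → ℝ),
          (fun q => H q * M q - (dd v H q * F q - dd w H q * G q)) =ᶠ[𝓝 q] fun _ => 0 := by
        intro v w F G M
        filter_upwards [notMem_tsupport_iff_eventuallyEq.1 hs,
          (dd_eventuallyEq (a := v) (notMem_tsupport_iff_eventuallyEq.1 hs)),
          (dd_eventuallyEq (a := w) (notMem_tsupport_iff_eventuallyEq.1 hs))] with y hy hv hw
        have hz : ∀ u : ℝ × ℝ, dd u (0 : ℝ × ℝ → ℝ) y = 0 := fun u => dd_const u 0 y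
        rw [hz] at hv hw
        simp [hy, hv, hw]
      have h2 : ∀ v w : ℝ × ℝ, dd v (dd w H) q = 0 := fun v w =>
        dd_eq_zero_of_notMem_tsupport fun h => hs (tsupport_dd_subset _ _ h)
      rw [dd_congr (h0 _ _ _ _ (fun q => Dx D q - Dy B q)),
        dd_congr (h0 _ _ _ _ (fun q => Dx B q - Dy A q)), h2, h2, h2, dd_const, dd_const]
      ring
  · exact fun q hq => hsm hq (fun h => ⟨(hreg q hq h).2.1, (hreg q hq h).1⟩)
      fun h => (cd (hreg q hq h).2.1 _).sub (cd (hreg q hq h).1 _)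
  · exact fun q hq => hsm hq (fun h => ⟨(hreg q hq h).2.2.1, (hreg q hq h).2.1⟩)
      fun h => (cd (hreg q hq h).2.2.1 _).sub (cd (hreg q hq h).2.1 _)

lemma isClosed_disc (p : ℝ × ℝ) (r : ℝ) : IsClosed (disc p r) :=
  isClosed_le (by fun_prop) (by fun_prop)

/-- The integral of a function that is a dominated limit, stationary off one point, of continuous
functions whose integral is known in polar coordinates. -/
lemma integral_eq_of_approx {p : ℝ × ℝ} {r ρ c : ℝ} (hρ : 0 ≤ ρ) (hr : ρ ≤ r)
    {F : ℕ → ℝ × ℝ → ℝ} {f N : ℝ × ℝ → ℝ} (hN : IntegrableOn N (disc p ρ))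
    (hb : ∀ n q, |F n q| ≤ N q) (hF0 : ∀ n, ∀ q ∉ disc p ρ, F n q = 0)
    (hf0 : ∀ q ∉ disc p ρ, f q = 0) (hc : ∀ n, ContinuousOn (F n) (disc p r))
    (hlim : ∀ q ≠ p, ∀ᶠ n in atTop, F n q = f q)
    (hpolar : ∀ n, ∫ s in (0 : ℝ)..r, ∫ t in (0 : ℝ)..(2 * π), s * F n (circ p s t) = c) :
    ∫ q, f q = c := by
  have hsub : disc p ρ ⊆ disc p r := fun q hq => le_trans hq (pow_le_pow_left₀ hρ hr 2)
  have h1 : ∀ n, ∫ q in disc p ρ, F n q = c := by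
    intro n
    rw [setIntegral_eq_integral_of_forall_compl_eq_zero (hF0 n), ← hpolar n]
    exact integral_eq_integral_polar (hρ.trans hr) (hc n) fun q hq =>
      hF0 n q fun h => absurd (hsub h) (not_le.2 hq)
  have h2 : Tendsto (fun n => ∫ q in disc p ρ, F n q) atTop (𝓝 (∫ q in disc p ρ, f q)) := by
    refine tendsto_integral_of_dominated_convergence N (fun n => ?_) hN
      (fun n => ae_of_all _ (hb n)) ?_
    · exact ((hc n).mono hsub).aestronglyMeasurable (isClosed_disc p ρ).measurableSet
    · have : ∀ᵐ q ∂(volume.restrict (disc p ρ)), q ≠ p :=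
        ae_restrict_of_ae (by simp [ae_iff])
      filter_upwards [this] with q hq
      exact tendsto_const_nhds.congr' ((hlim q hq).mono fun n hn => hn.symm)
  simp_rw [h1] at h2
  rw [← setIntegral_eq_integral_of_forall_compl_eq_zero hf0]
  exact tendsto_nhds_unique h2 tendsto_const_nhds

end Planar

/-! ### Cutoffs at small scale and the curl across a point singularity. -/

section Cutoff

open Real Filter Topology

lemma abs_dd_le {V : Type*} [NormedAddCommGroup V] [NormedSpace ℝ V] {f : V → ℝ} {x a : V}
    (ha : ‖a‖ ≤ 1) : |dd a f x| ≤ ‖fderiv ℝ f x‖ :=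
  ((fderiv ℝ f x).le_opNorm a).trans (mul_le_of_le_one_right (norm_nonneg _) ha)

lemma abs_dd_dd_le {V : Type*} [NormedAddCommGroup V] [NormedSpace ℝ V] {f : V → ℝ} {x a b : V}
    (hf : ContDiffAt ℝ 2 f x) (ha : ‖a‖ ≤ 1) (hb : ‖b‖ ≤ 1) :
    |dd a (dd b f) x| ≤ ‖fderiv ℝ (fderiv ℝ f) x‖ := by
  rw [dd_dd_eq hf]
  refine ((fderiv ℝ (fderiv ℝ f) x a).le_opNorm b).trans ?_
  exact (mul_le_of_le_one_right (norm_nonneg _) hb).trans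
    (((fderiv ℝ (fderiv ℝ f) x).le_opNorm a).trans (mul_le_of_le_one_right (norm_nonneg _) ha))

lemma exists_norm_clm_le {V W : Type*} [NormedAddCommGroup V] [NormedSpace ℝ V]
    [NormedAddCommGroup W] [NormedSpace ℝ W] {f : V → V →L[ℝ] W} (hf : Continuous f)
    (hc : HasCompactSupport f) : ∃ M, 0 ≤ M ∧ ∀ x, ‖f x‖ ≤ M := by
  obtain ⟨M, hM⟩ := hf.bounded_above_of_compact_support hc
  exact ⟨|M|, abs_nonneg _, fun x => (hM x).trans (le_abs_self M)⟩

/-- The first two derivatives of a twice differentiable function of compact support are bounded. -/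
lemma exists_bound_fderiv {V : Type*} [NormedAddCommGroup V] [NormedSpace ℝ V] {f : V → ℝ}
    (hf : ContDiff ℝ 2 f) (hc : HasCompactSupport f) :
    ∃ M, 0 ≤ M ∧ ∀ x, ‖fderiv ℝ f x‖ ≤ M ∧ ‖fderiv ℝ (fderiv ℝ f) x‖ ≤ M := by
  have h1 : ContDiff ℝ 1 (fderiv ℝ f) := hf.fderiv_right (by norm_num)
  have h2 : Continuous (fderiv ℝ (fderiv ℝ f)) := h1.continuous_fderiv (by norm_num)
  obtain ⟨M, h0, hM⟩ := exists_norm_clm_le h1.continuous (hc.fderiv ℝ)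
  obtain ⟨N, -, hN⟩ := exists_norm_clm_le h2 ((hc.fderiv ℝ).fderiv ℝ)
  exact ⟨max M N, le_max_of_le_left h0,
    fun x => ⟨(hM x).trans (le_max_left _ _), (hN x).trans (le_max_right _ _)⟩⟩

lemma dd_comp_homothety {V : Type*} [NormedAddCommGroup V] [NormedSpace ℝ V] {f : V → ℝ}
    (hf : Differentiable ℝ f) (a p : V) (k : ℝ) :
    dd a (fun q => f (k • (q - p))) = fun q => k * dd a f (k • (q - p)) := by
  ext q
  have h : HasFDerivAt (fun q => k • (q - p)) (k • ContinuousLinearMap.id ℝ V) q :=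
    ((hasFDerivAt_id q).sub_const p).const_smul k
  have h2 : HasFDerivAt (fun q => f (k • (q - p))) _ q := (hf (k • (q - p))).hasFDerivAt.comp q h
  simp [dd, h2.fderiv]

/-- A cutoff function at scale `ε` around `p`, with derivatives of the natural size. -/
structure IsCutoff (c : ℝ) (p : ℝ × ℝ) (ε : ℝ) (χ : ℝ × ℝ → ℝ) : Prop where
  contDiff : ContDiff ℝ 2 χ
  eq_one : χ =ᶠ[𝓝 p] fun _ => 1
  tsupport : tsupport χ ⊆ Metric.closedBall p (2 * ε)
  abs_le : ∀ q, |χ q| ≤ 1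
  abs_dd_le : ∀ a q, ‖a‖ ≤ 1 → |dd a χ q| ≤ c / ε
  abs_dd_dd_le : ∀ a b q, ‖a‖ ≤ 1 → ‖b‖ ≤ 1 → |dd a (dd b χ) q| ≤ c / ε ^ 2

/-- One fixed bump function is translated and rescaled. Each derivative costs a factor `1 / ε`, so
the same constant serves all centres and all scales. -/
lemma exists_isCutoff : ∃ c, 0 ≤ c ∧ ∀ p ε, 0 < ε → ∃ χ, IsCutoff c p ε χ := by
  let ψ : ContDiffBump (0 : ℝ × ℝ) := ⟨1, 2, by norm_num, by norm_num⟩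
  have hψ : ContDiff ℝ 2 ψ := ψ.contDiff
  obtain ⟨c, hc0, hc⟩ := exists_bound_fderiv hψ ψ.hasCompactSupport
  refine ⟨c, hc0, fun p ε hε => ⟨fun q => ψ (ε⁻¹ • (q - p)), ?_, ?_, ?_, ?_, ?_, ?_⟩⟩
  · exact hψ.comp (by fun_prop)
  · have h : Tendsto (fun q => ε⁻¹ • (q - p)) (𝓝 p) (𝓝 0) := by
      have : Continuous fun q : ℝ × ℝ => ε⁻¹ • (q - p) := by fun_prop
      simpa using this.tendsto p
    exact h.eventually ψ.eventuallyEq_one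
  · refine closure_minimal (fun q hq => ?_) Metric.isClosed_closedBall
    have h : ε⁻¹ • (q - p) ∈ Function.support ψ := hq
    rw [ψ.support_eq, mem_ball_zero_iff, norm_smul, norm_inv, norm_of_nonneg hε.le,
      inv_mul_lt_iff₀ hε] at h
    rw [mem_closedBall_iff_norm]
    change _ < ε * 2 at h
    linarith
  · intro q
    rw [abs_of_nonneg ψ.nonneg]
    exact ψ.le_one
  · intro a q ha
    rw [dd_comp_homothety (hψ.differentiable (by norm_num)), abs_mul, abs_of_pos (inv_pos.2 hε),
      div_eq_inv_mul]
    gcongr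
    exact (abs_dd_le ha).trans (hc _).1
  · intro a b q ha hb
    have h1 : ContDiff ℝ 1 (dd b ψ) := contDiff_dd hψ (by norm_num) b
    rw [dd_comp_homothety (hψ.differentiable (by norm_num)),
      dd_const_mul (f := fun q => dd b ψ (ε⁻¹ • (q - p))) _ _
        ((h1.comp (by fun_prop : ContDiff ℝ 1 fun q : ℝ × ℝ => ε⁻¹ • (q - p))).differentiable
          (by norm_num) q),
      dd_comp_homothety (h1.differentiable (by norm_num)), abs_mul, abs_mul,
      abs_of_pos (inv_pos.2 hε), ← mul_assoc, ← sq, div_eq_inv_mul, inv_pow]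
    gcongr
    exact (abs_dd_dd_le hψ.contDiffAt ha hb).trans (hc _).2

variable {c M ε : ℝ} {p : ℝ × ℝ} {χ R : ℝ × ℝ → ℝ}

lemma IsCutoff.dd_eq_zero (hχ : IsCutoff c p ε χ) {q : ℝ × ℝ} (hq : 2 * ε < ‖q - p‖) :
    χ =ᶠ[𝓝 q] 0 :=
  notMem_tsupport_iff_eventuallyEq.1 fun h =>
    absurd (mem_closedBall_iff_norm.1 (hχ.tsupport h)) (not_le.2 hq)

/-- On the support of the cutoff `‖q - p‖ ≤ 2ε`, so the loss `c / ε` from differentiating `χ` is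
compensated by `|R| ≤ M ‖q - p‖`. The bound is free of `ε`, which is what domination requires. -/
lemma IsCutoff.abs_dd_mul_le (hχ : IsCutoff c p ε χ) (hc : 0 ≤ c) (hε : 0 < ε) (hM : 0 ≤ M)
    (hR : ContDiff ℝ 1 R) (h0 : ∀ q, |R q| ≤ M * ‖q - p‖)
    (h1 : ∀ a q, ‖a‖ ≤ 1 → |dd a R q| ≤ M) {a : ℝ × ℝ} (ha : ‖a‖ ≤ 1) (q : ℝ × ℝ) :
    |dd a (fun y => χ y * R y) q| ≤ (2 * c + 1) * M := by
  by_cases hq : 2 * ε < ‖q - p‖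
  · have : (fun y => χ y * R y) =ᶠ[𝓝 q] fun _ => 0 := by
      filter_upwards [hχ.dd_eq_zero hq] with y hy
      simp [hy]
    rw [dd_congr this, dd_const, abs_zero]
    positivity
  · rw [not_lt] at hq
    rw [dd_mul (hχ.contDiff.differentiable (by norm_num) q) (hR.differentiable (by norm_num) q)]
    calc _ ≤ |dd a χ q| * |R q| + |χ q| * |dd a R q| := by
          rw [← abs_mul, ← abs_mul]; exact abs_add_le _ _
      _ ≤ (c / ε) * (M * (2 * ε)) + 1 * M := by
          gcongr
          · exact hχ.abs_dd_le a q ha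
          · exact (h0 q).trans (by gcongr)
          · exact hχ.abs_le q
          · exact h1 a q ha
      _ = (2 * c + 1) * M := by field_simp

lemma dd_dd_mul {V : Type*} [NormedAddCommGroup V] [NormedSpace ℝ V] {f g : V → ℝ}
    (hf : ContDiff ℝ 2 f) (hg : ContDiff ℝ 2 g) (a b q : V) :
    dd a (dd b fun y => f y * g y) q =
      dd a (dd b f) q * g q + dd b f q * dd a g q + (dd a f q * dd b g q + f q * dd a (dd b g) q) := by
  have df : Differentiable ℝ f := hf.differentiable (by norm_num)
  have dg : Differentiable ℝ g := hg.differentiable (by norm_num)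
  have ddf : Differentiable ℝ (dd b f) :=
    (contDiff_dd hf (m := 1) (by norm_num) b).differentiable (by norm_num)
  have ddg : Differentiable ℝ (dd b g) :=
    (contDiff_dd hg (m := 1) (by norm_num) b).differentiable (by norm_num)
  have e : dd b (fun y => f y * g y) = fun y => dd b f y * g y + f y * dd b g y :=
    funext fun y => dd_mul (df y) (dg y)
  have h1 : DifferentiableAt ℝ (fun y => dd b f y * g y) q := (ddf q).mul (dg q)
  have h2 : DifferentiableAt ℝ (fun y => f y * dd b g y) q := (df q).mul (ddg q)
  rw [e, dd_add h1 h2, dd_mul (ddf q) (dg q), dd_mul (df q) (ddg q)]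

/-- The same balance at second order, for a remainder of size `‖q - p‖ ^ 2`: in the constant, `4c`
comes from the second derivative of `χ`, `2c` from each of the two mixed terms, and `1` from the
second derivative of `R`. -/
lemma IsCutoff.abs_dd_dd_mul_le (hχ : IsCutoff c p ε χ) (hc : 0 ≤ c) (hε : 0 < ε) (hM : 0 ≤ M)
    (hR : ContDiff ℝ 2 R) (h0 : ∀ q, |R q| ≤ M * ‖q - p‖ ^ 2)
    (h1 : ∀ a q, ‖a‖ ≤ 1 → |dd a R q| ≤ M * ‖q - p‖)
    (h2 : ∀ a b q, ‖a‖ ≤ 1 → ‖b‖ ≤ 1 → |dd a (dd b R) q| ≤ M)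
    {a b : ℝ × ℝ} (ha : ‖a‖ ≤ 1) (hb : ‖b‖ ≤ 1) (q : ℝ × ℝ) :
    |dd a (dd b fun y => χ y * R y) q| ≤ (8 * c + 1) * M := by
  by_cases hq : 2 * ε < ‖q - p‖
  · have : (fun y => χ y * R y) =ᶠ[𝓝 q] fun _ => 0 := by
      filter_upwards [hχ.dd_eq_zero hq] with y hy
      simp [hy]
    have e : dd b (fun _ : ℝ × ℝ => (0 : ℝ)) = fun _ => 0 := funext fun y => dd_const b 0 y
    rw [dd_congr (dd_eventuallyEq this), e, dd_const, abs_zero]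
    positivity
  · rw [not_lt] at hq
    rw [dd_dd_mul hχ.contDiff hR]
    calc _ ≤ |dd a (dd b χ) q| * |R q| + |dd b χ q| * |dd a R q| +
          (|dd a χ q| * |dd b R q| + |χ q| * |dd a (dd b R) q|) := by
          have tri : ∀ x y z w : ℝ, |x + y + (z + w)| ≤ |x| + |y| + (|z| + |w|) := fun x y z w =>
            (abs_add_le _ _).trans (add_le_add (abs_add_le x y) (abs_add_le z w))
          simp only [← abs_mul]
          exact tri _ _ _ _
      _ ≤ (c / ε ^ 2) * (M * (2 * ε) ^ 2) + (c / ε) * (M * (2 * ε)) +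
          ((c / ε) * (M * (2 * ε)) + 1 * M) := by
          gcongr
          · exact hχ.abs_dd_dd_le a b q ha hb
          · exact (h0 q).trans (by gcongr)
          · exact hχ.abs_dd_le b q hb
          · exact (h1 a q ha).trans (by gcongr)
          · exact hχ.abs_dd_le a q ha
          · exact (h1 b q hb).trans (by gcongr)
          · exact hχ.abs_le q
          · exact h2 a b q ha hb
      _ = (8 * c + 1) * M := by field_simp; ring

/-- The norm of `ℝ × ℝ` is the supremum norm, so the ball is a square. Its half-side is at most `ρ /
2`, and its corners lie at Euclidean distance at most `ρ / √2`. -/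
lemma closedBall_subset_disc {p : ℝ × ℝ} {ρ ε : ℝ} (h : ε ≤ ρ / 4) :
    Metric.closedBall p (2 * ε) ⊆ disc p ρ := by
  intro q hq
  rw [mem_closedBall_iff_norm, Prod.norm_def, sup_le_iff, norm_eq_abs, norm_eq_abs, abs_le,
    abs_le] at hq
  simp only [Prod.fst_sub, Prod.snd_sub] at hq
  change (q.1 - p.1) ^ 2 + (q.2 - p.2) ^ 2 ≤ ρ ^ 2
  nlinarith

/-- Modification of a function near a point: for `W = χ R - g`, with `χ` a cutoff function,
`-W` equals `g - R` near the point and `g` away from it. -/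
lemma exists_modification {p : ℝ × ℝ} {ρ : ℝ} (hρ : 0 < ρ) {g R : ℝ × ℝ → ℝ}
    (hg : ContDiff ℝ 2 g) (hR : ContDiff ℝ 2 R) (hsupp : tsupport g ⊆ disc p ρ) :
    ∃ c, 0 ≤ c ∧ ∃ (ε : ℕ → ℝ) (χ : ℕ → ℝ × ℝ → ℝ) (W : ℕ → ℝ × ℝ → ℝ), (∀ n, 0 < ε n) ∧
      (∀ n, IsCutoff c p (ε n) (χ n)) ∧ (∀ n, W n = fun q => χ n q * R q - g q) ∧
      (∀ n, ContDiff ℝ 2 (W n)) ∧ (∀ n, tsupport (W n) ⊆ disc p ρ) ∧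
      (∀ n, p ∉ tsupport fun q => W n q + (g q - R q)) ∧
      ∀ q ≠ p, ∀ᶠ n in atTop, W n =ᶠ[𝓝 q] fun y => -g y := by
  obtain ⟨c, hc, H⟩ := exists_isCutoff
  -- The scales tend to 0, and the factor `ρ / 4` keeps the supports of all cutoffs inside the disc
  -- of radius `ρ`.
  have hε : ∀ n : ℕ, 0 < ρ / 4 * (1 / ((n : ℝ) + 1)) := fun n => by positivity
  choose χ hχ using fun n : ℕ => H p _ (hε n)
  refine ⟨c, hc, _, χ, fun n q => χ n q * R q - g q, hε, hχ, fun n => rfl,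
    fun n => ((hχ n).contDiff.mul hR).sub hg, fun n => ?_, fun n => ?_, fun q hq => ?_⟩
  · have hle : ρ / 4 * (1 / ((n : ℝ) + 1)) ≤ ρ / 4 := by
      refine mul_le_of_le_one_right (by positivity) ?_
      rw [div_le_one (by positivity)]
      linarith [(Nat.cast_nonneg n : (0 : ℝ) ≤ n)]
    refine closure_minimal (fun q hq => ?_) (isClosed_disc p ρ)
    by_contra hn
    have h1 : χ n q = 0 := image_eq_zero_of_notMem_tsupport fun h =>
      hn (closedBall_subset_disc hle ((hχ n).tsupport h))
    have h2 : g q = 0 := image_eq_zero_of_notMem_tsupport fun h => hn (hsupp h)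
    exact hq (by simp [h1, h2])
  · rw [notMem_tsupport_iff_eventuallyEq]
    filter_upwards [(hχ n).eq_one] with y hy
    simp [hy]
  · have h0 : Tendsto (fun n : ℕ => 2 * (ρ / 4 * (1 / ((n : ℝ) + 1)))) atTop (𝓝 0) := by
      simpa using (tendsto_one_div_add_atTop_nhds_zero_nat.const_mul (ρ / 4)).const_mul 2
    filter_upwards [h0.eventually_lt_const (norm_pos_iff.2 (sub_ne_zero.2 hq))] with n hn
    filter_upwards [(hχ n).dd_eq_zero hn] with y hy
    simp [hy]

lemma loop_congr {p : ℝ × ℝ} {r : ℝ} {a b a' b' : ℝ × ℝ → ℝ}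
    (h : ∀ t, a (circ p r t) = a' (circ p r t) ∧ b (circ p r t) = b' (circ p r t)) :
    loop p r a b = loop p r a' b' := by
  unfold loop
  exact intervalIntegral.integral_congr fun t _ => by simp only [(h t).1, (h t).2]

lemma loop_const_mul {p : ℝ × ℝ} {r : ℝ} (k : ℝ) (a b : ℝ × ℝ → ℝ) :
    loop p r (fun q => k * a q) (fun q => k * b q) = k * loop p r a b := by
  unfold loop
  rw [← intervalIntegral.integral_const_mul]
  exact intervalIntegral.integral_congr fun t _ => by ring

lemma circ_notMem_disc {p : ℝ × ℝ} {r ρ : ℝ} (hρ : 0 < ρ) (hr : ρ < r) (t : ℝ) :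
    circ p r t ∉ disc p ρ := by
  intro h
  have : (r * cos t) ^ 2 + (r * sin t) ^ 2 ≤ ρ ^ 2 := by simpa [circ, disc] using h
  rw [mul_pow, mul_pow, ← mul_add, cos_sq_add_sin_sq, mul_one] at this
  nlinarith

lemma continuousAt_mul_of_tsupport {V : Type*} [NormedAddCommGroup V] [NormedSpace ℝ V]
    {f g : V → ℝ} {x : V} (hf : ContinuousAt f x) (hg : x ∈ tsupport f → ContinuousAt g x) :
    ContinuousAt (fun y => f y * g y) x := by
  by_cases hx : x ∈ tsupport f
  · exact hf.mul (hg hx)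
  · have : (fun y => f y * g y) =ᶠ[nhds x] fun _ => 0 := by
      filter_upwards [notMem_tsupport_iff_eventuallyEq.1 hx] with y hy
      simp [hy]
    exact continuousAt_const.congr this.symm

lemma hasCompactSupport_of_subset_disc {p : ℝ × ℝ} {ρ : ℝ} {g : ℝ × ℝ → ℝ}
    (h : tsupport g ⊆ disc p ρ) : HasCompactSupport g := by
  refine IsCompact.of_isClosed_subset (isCompact_closedBall p |ρ|) (isClosed_tsupport g)
    (h.trans fun q hq => ?_)
  have hq' : (q.1 - p.1) ^ 2 + (q.2 - p.2) ^ 2 ≤ ρ ^ 2 := hq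
  rw [mem_closedBall_iff_norm, Prod.norm_def, sup_le_iff]
  constructor
  · exact abs_le_of_sq_le_sq' (by rw [sq_abs]; simp; nlinarith) (abs_nonneg _) |> abs_le.2
  · exact abs_le_of_sq_le_sq' (by rw [sq_abs]; simp; nlinarith) (abs_nonneg _) |> abs_le.2

/-- The distributional curl of an integrable one-form that is closed off one point. -/
theorem integral_curl {p : ℝ × ℝ} {r ρ : ℝ} (hρ : 0 < ρ) (hr : ρ < r) {a b g : ℝ × ℝ → ℝ}
    (hreg : ∀ q ∈ disc p r, q ≠ p →
      ContDiffAt ℝ 1 a q ∧ ContDiffAt ℝ 1 b q ∧ Dx b q - Dy a q = 0)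
    (ha : IntegrableOn a (disc p ρ)) (hb : IntegrableOn b (disc p ρ))
    (hg : ContDiff ℝ 2 g) (hsupp : tsupport g ⊆ disc p ρ) :
    ∫ q, -(Dx g q * b q - Dy g q * a q) = g p * loop p r a b := by
  obtain ⟨M, hM, hbd⟩ := exists_bound_fderiv hg (hasCompactSupport_of_subset_disc hsupp)
  -- First derivatives of `g` enter the integral, so the remainder need only vanish to first order
  -- at `p`: the constant Taylor polynomial suffices.
  set R : ℝ × ℝ → ℝ := fun q => g q - g p with hRdef
  have hR : ContDiff ℝ 2 R := hg.sub contDiff_const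
  have dg : Differentiable ℝ g := hg.differentiable (by norm_num)
  have hR0 : ∀ q, |R q| ≤ M * ‖q - p‖ := fun q =>
    convex_univ.norm_image_sub_le_of_norm_fderiv_le (fun x _ => dg x) (fun x _ => (hbd x).1)
      (Set.mem_univ p) (Set.mem_univ q)
  have hR1 : ∀ v q, ‖v‖ ≤ 1 → |dd v R q| ≤ M := by
    intro v q hv
    rw [hRdef, dd_sub (dg q) (differentiableAt_const _), dd_const, sub_zero]
    exact (abs_dd_le hv).trans (hbd q).1
  obtain ⟨c, hc, ε, χ, W, hε, hχ, hW, hWd, hWs, hWp, hWl⟩ := exists_modification hρ hg hR hsupp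
  have n1 : ‖((1, 0) : ℝ × ℝ)‖ ≤ 1 := by simp
  have n2 : ‖((0, 1) : ℝ × ℝ)‖ ≤ 1 := by simp
  have hbound : ∀ n v q, ‖v‖ ≤ 1 → |dd v (W n) q| ≤ (2 * c + 1) * M + M := by
    intro n v q hv
    have hd : DifferentiableAt ℝ (fun y => χ n y * R y) q :=
      ((hχ n).contDiff.mul hR).differentiable (by norm_num) q
    rw [hW, dd_sub hd (dg q)]
    refine (abs_sub _ _).trans (add_le_add ?_ ((abs_dd_le hv).trans (hbd q).1))
    exact (hχ n).abs_dd_mul_le hc (hε n) hM (hR.of_le (by norm_num)) hR0 hR1 hv q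
  refine integral_eq_of_approx (p := p) (F := fun n q => Dx (W n) q * b q - Dy (W n) q * a q)
    (N := fun q => ((2 * c + 1) * M + M) * (|b q| + |a q|)) hρ.le hr.le ?_ ?_ ?_ ?_ ?_ ?_ ?_
  · exact (hb.abs.add ha.abs).const_mul _
  · intro n q
    calc _ ≤ |Dx (W n) q| * |b q| + |Dy (W n) q| * |a q| := by
          rw [← abs_mul, ← abs_mul]; exact abs_sub _ _
      _ ≤ ((2 * c + 1) * M + M) * |b q| + ((2 * c + 1) * M + M) * |a q| := by
          gcongr
          · exact hbound n _ q n1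
          · exact hbound n _ q n2
      _ = _ := by ring
  · intro n q hq
    have h : ∀ v, dd v (W n) q = 0 := fun v =>
      dd_eq_zero_of_notMem_tsupport fun h => hq (hWs n h)
    simp [h]
  · intro q hq
    have h : ∀ v, dd v g q = 0 := fun v =>
      dd_eq_zero_of_notMem_tsupport fun h => hq (hsupp h)
    simp [h]
  · intro n q hq
    have hdW : ∀ v, ContinuousAt (dd v (W n)) q := fun v =>
      (contDiff_dd (hWd n) (m := 1) (by norm_num) v).continuous.continuousAt
    -- The form may blow up at `p`, but `W n` is constant near `p`, so its derivatives vanish there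
    -- and the product stays continuous.
    have hne : ∀ v, q ∈ tsupport (dd v (W n)) → q ≠ p := by
      rintro v h rfl
      have e : (fun y => W n y) =ᶠ[𝓝 q] fun _ => -g q := by
        filter_upwards [notMem_tsupport_iff_eventuallyEq.1 (hWp n)] with y hy
        simp [hRdef] at hy
        linarith
      have e2 : dd v (W n) =ᶠ[𝓝 q] fun _ => 0 := by
        have := dd_eventuallyEq (a := v) e
        filter_upwards [this] with y hy
        rw [hy, dd_const]
      exact notMem_tsupport_iff_eventuallyEq.2 e2 h
    exact ((continuousAt_mul_of_tsupport (hdW _) fun h => (hreg q hq (hne _ h)).2.1.continuousAt).sub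
      (continuousAt_mul_of_tsupport (hdW _)
        fun h => (hreg q hq (hne _ h)).1.continuousAt)).continuousWithinAt
  · intro q hq
    filter_upwards [hWl q hq] with n hn
    have h : ∀ v, dd v (W n) q = -dd v g q := fun v => by
      rw [dd_congr hn]; simp [dd]
    simp only [h]; ring
  · intro n
    -- `H` is `W n` plus the constant `g p`. It has the same derivatives as `W n`, vanishes near the
    -- singular point, so that Green's formula holds on the whole disc, and equals `g p` on the
    -- outer circle.
    set H : ℝ × ℝ → ℝ := fun q => W n q + (g q - R q) with hH
    have hHW : H = fun q => W n q + g p := by ext q; simp [hH, hRdef]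
    have hHd : ContDiff ℝ 2 H := (hWd n).add (hg.sub hR)
    have hdH : ∀ v q, dd v H q = dd v (W n) q := by
      intro v q
      rw [hHW, dd_add ((hWd n).differentiable (by norm_num) q) (differentiableAt_const _),
        dd_const, add_zero]
    have := loop_mul_eq_integral_polar (K := 0) (hρ.le.trans hr.le) (H := H) (a := a) (b := b)
      (hHd.of_le (by norm_num)) fun q hq hs => hreg q hq fun h => hWp n (h ▸ hs)
    simp only [hdH, mul_zero, add_zero] at this
    rw [← this, ← loop_const_mul]
    refine loop_congr fun t => ?_
    have h0 : W n (circ p r t) = 0 := image_eq_zero_of_notMem_tsupport fun h =>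
      circ_notMem_disc hρ hr t (hWs n h)
    simp [hHW, h0]

end Cutoff

/-! ### Taylor remainder and the incompatibility across a point singularity. -/

section Incompatibility

open Real Filter Topology

lemma dd_neg {V : Type*} [NormedAddCommGroup V] [NormedSpace ℝ V] (a : V) (f : V → ℝ) :
    dd a (fun y => -f y) = fun y => -dd a f y := by
  ext; simp [dd]

/-- The first order Taylor polynomial of `g` at `p`. -/
def affinePart (g : ℝ × ℝ → ℝ) (p q : ℝ × ℝ) : ℝ := g p + fderiv ℝ g p (q - p)

lemma contDiff_affinePart (g : ℝ × ℝ → ℝ) (p : ℝ × ℝ) {n : WithTop ℕ∞} :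
    ContDiff ℝ n (affinePart g p) := by
  unfold affinePart; fun_prop

lemma fderiv_affinePart (g : ℝ × ℝ → ℝ) (p q : ℝ × ℝ) :
    fderiv ℝ (affinePart g p) q = fderiv ℝ g p := by
  have h : HasFDerivAt (fun q => g p + fderiv ℝ g p (q - p)) (fderiv ℝ g p) q := by
    simpa using ((fderiv ℝ g p).hasFDerivAt.comp q ((hasFDerivAt_id q).sub_const p)).const_add (g p)
  exact h.fderiv

lemma dd_affinePart (g : ℝ × ℝ → ℝ) (p v : ℝ × ℝ) :
    dd v (affinePart g p) = fun _ => dd v g p := by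
  ext q; simp [dd, fderiv_affinePart]

/-- The remainder of a first order Taylor expansion. -/
lemma remainder_bounds {g : ℝ × ℝ → ℝ} (hg : ContDiff ℝ 2 g) {M : ℝ} (hM : 0 ≤ M)
    (hbd : ∀ x, ‖fderiv ℝ (fderiv ℝ g) x‖ ≤ M) (p q : ℝ × ℝ) :
    ‖fderiv ℝ (fun q => g q - affinePart g p q) q‖ ≤ M * ‖q - p‖ ∧
      |g q - affinePart g p q| ≤ M * ‖q - p‖ ^ 2 := by
  have dg : Differentiable ℝ g := hg.differentiable (by norm_num)
  have dl : Differentiable ℝ (affinePart g p) :=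
    (contDiff_affinePart g p (n := 1)).differentiable (by norm_num)
  have ddg : Differentiable ℝ (fderiv ℝ g) :=
    (hg.fderiv_right (m := 1) (by norm_num)).differentiable (by norm_num)
  have h1 : ∀ q, ‖fderiv ℝ (fun q => g q - affinePart g p q) q‖ ≤ M * ‖q - p‖ := by
    intro q
    rw [fderiv_fun_sub (dg q) (dl q), fderiv_affinePart]
    exact convex_univ.norm_image_sub_le_of_norm_fderiv_le (fun x _ => ddg x) (fun x _ => hbd x)
      (Set.mem_univ p) (Set.mem_univ q)
  refine ⟨h1 q, ?_⟩
  -- The mean value inequality on the ball reaching just to `q`, where the gradient of the remainder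
  -- is at most `M ‖q - p‖`.
  have h2 := (convex_closedBall p ‖q - p‖).norm_image_sub_le_of_norm_fderiv_le
    (f := fun q => g q - affinePart g p q) (𝕜 := ℝ) (C := M * ‖q - p‖)
    (fun x _ => (dg x).sub (dl x))
    (fun x hx => (h1 x).trans (by gcongr; exact mem_closedBall_iff_norm.1 hx))
    (Metric.mem_closedBall_self (norm_nonneg _)) (mem_closedBall_iff_norm.2 le_rfl)
  have h3 : g p - affinePart g p p = 0 := by simp [affinePart]
  rw [h3, sub_zero, norm_eq_abs] at h2
  linarith [h2, mul_assoc M ‖q - p‖ ‖q - p‖, sq ‖q - p‖, congrArg (M * ·) (sq ‖q - p‖)]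

/-- The distributional incompatibility of an integrable planar tensor that is compatible off one
point. -/
theorem integral_incompatibility {p : ℝ × ℝ} {r ρ : ℝ} (hρ : 0 < ρ) (hr : ρ < r)
    {A B D g : ℝ × ℝ → ℝ} (hreg : ∀ q ∈ disc p r, q ≠ p → CompatibleAt A B D q)
    (hA : IntegrableOn A (disc p ρ)) (hB : IntegrableOn B (disc p ρ))
    (hD : IntegrableOn D (disc p ρ)) (hg : ContDiff ℝ 2 g) (hsupp : tsupport g ⊆ disc p ρ) :
    ∫ q, (Dx (Dx g) q * D q - 2 * Dx (Dy g) q * B q + Dy (Dy g) q * A q) =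
      loop p r
        (fun q => affinePart g p q * (Dx B q - Dy A q) - (Dx g p * B q - Dy g p * A q))
        (fun q => affinePart g p q * (Dx D q - Dy B q) - (Dx g p * D q - Dy g p * B q)) := by
  obtain ⟨M, hM, hbd⟩ := exists_bound_fderiv hg (hasCompactSupport_of_subset_disc hsupp)
  -- Second derivatives of `g` now enter, so the remainder must vanish to second order at `p`. The
  -- affine Taylor polynomial is what finally produces `δ_p` and its first derivatives, and nothing
  -- of higher order.
  set R : ℝ × ℝ → ℝ := fun q => g q - affinePart g p q with hRdef
  have hR : ContDiff ℝ 2 R := hg.sub (contDiff_affinePart g p)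
  have hRb := remainder_bounds hg hM (fun x => (hbd x).2) p
  have cd : ∀ {f : ℝ × ℝ → ℝ}, ContDiff ℝ 2 f → ∀ v, ContDiff ℝ 1 (dd v f) :=
    fun hf v => contDiff_dd hf (by norm_num) v
  have df : ∀ {f : ℝ × ℝ → ℝ}, ContDiff ℝ 1 f → Differentiable ℝ f :=
    fun hf => hf.differentiable (by norm_num)
  have df2 : ∀ {f : ℝ × ℝ → ℝ}, ContDiff ℝ 2 f → Differentiable ℝ f :=
    fun hf => hf.differentiable (by norm_num)
  have ddsub : ∀ {f h : ℝ × ℝ → ℝ}, ContDiff ℝ 2 f → ContDiff ℝ 2 h → ∀ v w q,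
      dd v (dd w fun y => f y - h y) q = dd v (dd w f) q - dd v (dd w h) q := by
    intro f h hf hh v w q
    have : dd w (fun y => f y - h y) = fun y => dd w f y - dd w h y :=
      funext fun y => dd_sub (df2 hf y) (df2 hh y)
    rw [this, dd_sub (df (cd hf w) q) (df (cd hh w) q)]
  have hR1 : ∀ v q, ‖v‖ ≤ 1 → |dd v R q| ≤ M * ‖q - p‖ := fun v q hv =>
    (abs_dd_le hv).trans (hRb q).1
  have hR2 : ∀ v w q, ‖v‖ ≤ 1 → ‖w‖ ≤ 1 → |dd v (dd w R) q| ≤ M := by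
    intro v w q hv hw
    rw [hRdef, ddsub hg (contDiff_affinePart g p), dd_affinePart, dd_const, sub_zero]
    exact (abs_dd_dd_le hg.contDiffAt hv hw).trans (hbd q).2
  obtain ⟨c, hc, ε, χ, W, hε, hχ, hW, hWd, hWs, hWp, hWl⟩ := exists_modification hρ hg hR hsupp
  have n1 : ‖((1, 0) : ℝ × ℝ)‖ ≤ 1 := by simp
  have n2 : ‖((0, 1) : ℝ × ℝ)‖ ≤ 1 := by simp
  have hbound : ∀ n v w q, ‖v‖ ≤ 1 → ‖w‖ ≤ 1 →
      |dd v (dd w (W n)) q| ≤ (8 * c + 1) * M + M := by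
    intro n v w q hv hw
    rw [hW, ddsub ((hχ n).contDiff.mul hR) hg]
    refine (abs_sub _ _).trans
      (add_le_add ?_ ((abs_dd_dd_le hg.contDiffAt hv hw).trans (hbd q).2))
    exact (hχ n).abs_dd_dd_mul_le hc (hε n) hM hR (fun q => (hRb q).2) hR1 hR2 hv hw q
  refine integral_eq_of_approx (p := p) (F := fun n q =>
      -(Dx (Dx (W n)) q * D q - 2 * Dx (Dy (W n)) q * B q + Dy (Dy (W n)) q * A q))
    (N := fun q => ((8 * c + 1) * M + M) * (|D q| + 2 * |B q| + |A q|)) hρ.le hr.le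
    ?_ ?_ ?_ ?_ ?_ ?_ ?_
  · exact ((hD.abs.add (hB.abs.const_mul 2)).add hA.abs).const_mul _
  · intro n q
    have tri : ∀ x y z : ℝ, |-(x - 2 * y + z)| ≤ |x| + 2 * |y| + |z| := fun x y z => by
      rw [abs_neg]
      calc _ ≤ |x - 2 * y| + |z| := abs_add_le _ _
        _ ≤ |x| + |2 * y| + |z| := by gcongr; exact abs_sub _ _
        _ = _ := by rw [abs_mul, abs_two]
    have := tri (Dx (Dx (W n)) q * D q) (Dx (Dy (W n)) q * B q) (Dy (Dy (W n)) q * A q)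
    rw [abs_mul, abs_mul, abs_mul, ← mul_assoc] at this
    calc _ ≤ _ := this
      _ ≤ ((8 * c + 1) * M + M) * |D q| + 2 * (((8 * c + 1) * M + M) * |B q|) +
          ((8 * c + 1) * M + M) * |A q| := by
          gcongr
          · exact hbound n _ _ q n1 n1
          · exact hbound n _ _ q n1 n2
          · exact hbound n _ _ q n2 n2
      _ = _ := by ring
  · intro n q hq
    have h : ∀ v w, dd v (dd w (W n)) q = 0 := fun v w => dd_eq_zero_of_notMem_tsupport fun h =>
      hq (hWs n (tsupport_dd_subset _ _ h))
    simp [h]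
  · intro q hq
    have h : ∀ v w, dd v (dd w g) q = 0 := fun v w => dd_eq_zero_of_notMem_tsupport fun h =>
      hq (hsupp (tsupport_dd_subset _ _ h))
    simp [h]
  · intro n q hq
    have hdW : ∀ v w, ContinuousAt (dd v (dd w (W n))) q := fun v w =>
      (contDiff_dd (cd (hWd n) w) (m := 0) (by norm_num) v).continuous.continuousAt
    have hne : ∀ v w, q ∈ tsupport (dd v (dd w (W n))) → q ≠ p := by
      rintro v w h rfl
      have e : (fun y => W n y) =ᶠ[𝓝 q] fun y => 0 - affinePart g q y := by
        filter_upwards [notMem_tsupport_iff_eventuallyEq.1 (hWp n)] with y hy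
        simp [hRdef] at hy
        linarith
      have e2 : dd v (dd w (W n)) =ᶠ[𝓝 q] fun _ => 0 := by
        filter_upwards [dd_eventuallyEq (a := v) (dd_eventuallyEq (a := w) e)] with y hy
        rw [hy, ddsub contDiff_const (contDiff_affinePart g q), dd_affinePart, dd_const]
        have : dd w (fun _ : ℝ × ℝ => (0 : ℝ)) = fun _ => 0 := funext fun y => dd_const w 0 y
        rw [this, dd_const, sub_zero]
      exact notMem_tsupport_iff_eventuallyEq.2 e2 h
    have key : ∀ (v w : ℝ × ℝ) (f : ℝ × ℝ → ℝ), (q ≠ p → ContinuousAt f q) →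
        ContinuousAt (fun q => dd v (dd w (W n)) q * f q) q := fun v w f hf =>
      continuousAt_mul_of_tsupport (hdW v w) fun h => hf (hne v w h)
    have k1 := key (1, 0) (1, 0) D fun h => (hreg q hq h).2.2.1.continuousAt
    have k2 := key (1, 0) (0, 1) B fun h => (hreg q hq h).2.1.continuousAt
    have k3 := key (0, 1) (0, 1) A fun h => (hreg q hq h).1.continuousAt
    have k4 := ((k1.sub (k2.const_mul 2)).add k3).neg
    simp only [mul_assoc]
    exact k4.continuousWithinAt
  · intro q hq
    filter_upwards [hWl q hq] with n hn
    have h : ∀ v w, dd v (dd w (W n)) q = -dd v (dd w g) q := fun v w => by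
      rw [dd_congr (dd_eventuallyEq hn)]
      rw [dd_neg, dd_neg]
    simp only [h]; ring
  · intro n
    -- `H` is `W n` plus the Taylor polynomial. It has the same second derivatives as `W n`,
    -- vanishes near `p`, and coincides with the polynomial near the outer circle, since `W n` is
    -- supported in the smaller disc.
    set H : ℝ × ℝ → ℝ := fun q => W n q + (g q - R q) with hH
    have hHW : H = fun q => W n q - (0 - affinePart g p q) := by ext q; simp [hH, hRdef]
    have hla : ContDiff ℝ 2 fun q => 0 - affinePart g p q :=
      contDiff_const.sub (contDiff_affinePart g p)
    have hHd : ContDiff ℝ 2 H := (hWd n).add (hg.sub hR)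
    have hl1 : ∀ w, dd w (fun q => 0 - affinePart g p q) = fun _ => - dd w g p := by
      intro w
      ext q
      rw [dd_sub (differentiableAt_const _)
        ((contDiff_affinePart g p (n := 1)).differentiable (by norm_num) q), dd_const,
        dd_affinePart, zero_sub]
    have hdH : ∀ v w q, dd v (dd w H) q = dd v (dd w (W n)) q := by
      intro v w q
      rw [hHW, ddsub (hWd n) hla, hl1, dd_const, sub_zero]
    have := loop_incompatibility (hρ.le.trans hr.le) (A := A) (B := B) (D := D) hHd
      fun q hq hs => hreg q hq fun h => hWp n (h ▸ hs)
    simp only [hdH] at this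
    rw [← this]
    refine loop_congr fun t => ?_
    have hnot : circ p r t ∉ tsupport (W n) := fun h => circ_notMem_disc hρ hr t (hWs n h)
    have h0 : W n (circ p r t) = 0 := image_eq_zero_of_notMem_tsupport hnot
    have h1 : ∀ w, dd w H (circ p r t) = dd w g p := by
      intro w
      rw [hHW, dd_sub (df2 (hWd n) _) (df2 hla _), hl1, dd_eq_zero_of_notMem_tsupport hnot]
      ring
    have h2 : H (circ p r t) = affinePart g p (circ p r t) := by rw [hHW]; simp [h0]
    simp only [h1, h2, and_self]

end Incompatibility

/-! ### Circulation along a circle: linearity and exact forms. -/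

section Loops

open Real Filter Topology

variable {p : ℝ × ℝ} {r : ℝ}

lemma hasDerivAt_circ (p : ℝ × ℝ) (r t : ℝ) :
    HasDerivAt (circ p r) (-(r * sin t), r * cos t) t := by
  have h1 := ((hasDerivAt_cos t).const_mul r).const_add p.1
  have h2 := ((hasDerivAt_sin t).const_mul r).const_add p.2
  rw [mul_neg] at h1
  exact h1.prodMk h2

/-- The integral of an exact form along a circle vanishes. -/
lemma loop_exact {f : ℝ × ℝ → ℝ} (hf : ∀ t, ContDiffAt ℝ 1 f (circ p r t)) :
    loop p r (Dx f) (Dy f) = 0 := by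
  have hd : ∀ t, HasDerivAt (fun t => f (circ p r t))
      (Dx f (circ p r t) * (-(r * sin t)) + Dy f (circ p r t) * (r * cos t)) t := by
    intro t
    have := ((hf t).differentiableAt (by norm_num)).hasFDerivAt.comp_hasDerivAt t
      (hasDerivAt_circ p r t)
    rw [fderiv_apply_prod] at this
    convert! this using 1
    ring
  have hc : ∀ v, Continuous fun t => dd v f (circ p r t) := fun v =>
    continuous_iff_continuousAt.2 fun t => ContinuousAt.comp (g := dd v f)
      (contDiffAt_dd (hf t) (m := 0) (by norm_num) v).continuousAt
      (hasDerivAt_circ p r t).continuousAt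
  have := intervalIntegral.integral_eq_sub_of_hasDerivAt (a := 0) (b := 2 * π)
    (fun t _ => hd t) (Continuous.intervalIntegrable (by
      have h1 := hc (1, 0)
      have h2 := hc (0, 1)
      fun_prop) _ _)
  unfold loop
  rw [this]
  simp [circ]

lemma loop_add {a b a' b' : ℝ × ℝ → ℝ} (ha : Continuous fun t => a (circ p r t))
    (hb : Continuous fun t => b (circ p r t)) (ha' : Continuous fun t => a' (circ p r t))
    (hb' : Continuous fun t => b' (circ p r t)) :
    loop p r (fun q => a q + a' q) (fun q => b q + b' q) = loop p r a b + loop p r a' b' := by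
  unfold loop
  rw [← intervalIntegral.integral_add]
  · exact intervalIntegral.integral_congr fun t _ => by ring
  · exact Continuous.intervalIntegrable
      ((ha.mul (by fun_prop : Continuous fun t => -(r * sin t))).add
        (hb.mul (by fun_prop : Continuous fun t => r * cos t))) _ _
  · exact Continuous.intervalIntegrable
      ((ha'.mul (by fun_prop : Continuous fun t => -(r * sin t))).add
        (hb'.mul (by fun_prop : Continuous fun t => r * cos t))) _ _

lemma continuous_dd_circ {f : ℝ × ℝ → ℝ} (hf : ∀ t, ContDiffAt ℝ 1 f (circ p r t)) (v : ℝ × ℝ) :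
    Continuous fun t => dd v f (circ p r t) :=
  continuous_iff_continuousAt.2 fun t => ContinuousAt.comp (g := dd v f)
    (contDiffAt_dd (hf t) (m := 0) (by norm_num) v).continuousAt
    (hasDerivAt_circ p r t).continuousAt

lemma continuous_comp_circ {f : ℝ × ℝ → ℝ} (hf : ∀ t, ContDiffAt ℝ 1 f (circ p r t)) :
    Continuous fun t => f (circ p r t) :=
  continuous_iff_continuousAt.2 fun t => ContinuousAt.comp (g := f) (hf t).continuousAt
    (hasDerivAt_circ p r t).continuousAt

/-- Adding an exact form does not change the integral along a circle. -/
lemma loop_add_exact {f a b : ℝ × ℝ → ℝ} (hf : ∀ t, ContDiffAt ℝ 1 f (circ p r t))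
    (ha : Continuous fun t => a (circ p r t)) (hb : Continuous fun t => b (circ p r t)) :
    loop p r (fun q => a q + Dx f q) (fun q => b q + Dy f q) = loop p r a b := by
  rw [loop_add ha hb (continuous_dd_circ hf _) (continuous_dd_circ hf _), loop_exact hf, add_zero]

end Loops

/-! ### Splitting space into plane and height. -/

section Space

open Real Filter Topology

/-- The point of planar coordinates `q` at height `z`. -/
def pt (q : ℝ × ℝ) (z : ℝ) : R3 := !₂[q.1, q.2, z]

/-- The point of the plane of coordinates `q`. -/
def toR2 (q : ℝ × ℝ) : R2 := !₂[q.1, q.2]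

@[simp] lemma pt_zero (q : ℝ × ℝ) (z : ℝ) : pt q z 0 = q.1 := rfl
@[simp] lemma pt_one (q : ℝ × ℝ) (z : ℝ) : pt q z 1 = q.2 := rfl
@[simp] lemma pt_two (q : ℝ × ℝ) (z : ℝ) : pt q z 2 = z := rfl

@[simp] lemma planar_pt (q : ℝ × ℝ) (z : ℝ) : planar (pt q z) = toR2 q := rfl

lemma pt_eta (x : R3) : pt (x 0, x 1) (x 2) = x := by
  ext i; fin_cases i <;> rfl

@[fun_prop]
lemma contDiff_pt {n : WithTop ℕ∞} : ContDiff ℝ n fun w : (ℝ × ℝ) × ℝ => pt w.1 w.2 := by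
  rw [contDiff_euclidean]
  intro i
  fin_cases i
  · exact contDiff_fst.fst
  · exact contDiff_fst.snd
  · exact contDiff_snd

/-- The Cartesian coordinates of space, the vertical one apart. -/
def ptEquiv : (ℝ × ℝ) × ℝ ≃ᵐ R3 where
  toFun w := pt w.1 w.2
  invFun x := ((x 0, x 1), x 2)
  left_inv _ := rfl
  right_inv := pt_eta
  measurable_toFun := (contDiff_pt (n := 0)).continuous.measurable
  measurable_invFun := by
    have : Continuous fun x : R3 => (((x 0, x 1), x 2) : (ℝ × ℝ) × ℝ) := by fun_prop
    exact this.measurable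

lemma measurePreserving_ptEquiv : MeasurePreserving ptEquiv volume volume := by
  have h1 := (EuclideanSpace.volume_preserving_symm_measurableEquiv_toLp (Fin 3))
  have h2 := volume_preserving_piFinSuccAbove (fun _ : Fin 3 => ℝ) 2
  have h3 := (MeasurePreserving.id (volume : Measure ℝ)).prod (volume_preserving_finTwoArrow ℝ)
  -- Removing the coordinate of index 2 places the height first, hence the exchange of factors.
  have h4 : MeasurePreserving (Prod.swap : ℝ × (ℝ × ℝ) → (ℝ × ℝ) × ℝ) volume volume :=
    Measure.measurePreserving_swap
  have h5 : MeasurePreserving ptEquiv.symm volume volume := h4.comp (h3.comp (h2.comp h1))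
  exact h5.symm ptEquiv.symm

lemma integral_eq_integral_pt (f : R3 → ℝ) : ∫ x, f x = ∫ w : (ℝ × ℝ) × ℝ, f (pt w.1 w.2) :=
  (measurePreserving_ptEquiv.integral_comp' f).symm

lemma pt_eq (q : ℝ × ℝ) (z : ℝ) : pt q z = q.1 • e 0 + q.2 • e 1 + z • e 2 := by
  ext i; fin_cases i <;> simp [pt, e]

lemma hasFDerivAt_pt (q : ℝ × ℝ) (z : ℝ) :
    HasFDerivAt (fun q => pt q z) ((ContinuousLinearMap.fst ℝ ℝ ℝ).smulRight (e 0) +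
      (ContinuousLinearMap.snd ℝ ℝ ℝ).smulRight (e 1)) q := by
  simp only [pt_eq]
  exact ((hasFDerivAt_fst.smul_const (e 0)).add (hasFDerivAt_snd.smul_const (e 1))).add_const _

lemma dd_comp_pt {f : R3 → ℝ} {q : ℝ × ℝ} {z : ℝ} (hf : DifferentiableAt ℝ f (pt q z)) :
    Dx (fun q => f (pt q z)) q = pd 0 f (pt q z) ∧ Dy (fun q => f (pt q z)) q = pd 1 f (pt q z) := by
  have h : HasFDerivAt (fun q => f (pt q z)) _ q := hf.hasFDerivAt.comp q (hasFDerivAt_pt q z)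
  simp [dd, pd, h.fderiv]

lemma hasDerivAt_comp_pt {f : R3 → ℝ} {q : ℝ × ℝ} {z : ℝ} (hf : DifferentiableAt ℝ f (pt q z)) :
    HasDerivAt (fun z => f (pt q z)) (pd 2 f (pt q z)) z := by
  have h : HasDerivAt (fun z => pt q z) (e 2) z := by
    simp only [pt_eq]
    simpa using ((hasDerivAt_id z).smul_const (e 2)).const_add (q.1 • e 0 + q.2 • e 1)
  exact hf.hasFDerivAt.comp_hasDerivAt z h

end Space

/-! ### Small cylinders around the points of the domain. -/

section Cylinders

open Real Filter Topology

/-- A small closed vertical cylinder around the vertical line through `p`, together with a larger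
flat disc, at a possibly different height, that meets the defect lines at most in its centre. -/
structure IsCylinder (Ω : Opens R3) (P : Set R2) (C : Loops) (p : ℝ × ℝ) (z₀ zs r ρ : ℝ) :
    Prop where
  pos : 0 < ρ
  lt : ρ < r
  box : ∀ q ∈ disc p ρ, ∀ z, |z - z₀| ≤ ρ → pt q z ∈ Ω
  punctured : ∀ q ∈ disc p r, q ≠ p → pt q zs ∈ regularPart Ω P
  loop_eq : toR2 p ∈ P → C.height (toR2 p) = zs ∧ C.radius (toR2 p) = r
  center : toR2 p ∉ P → pt p zs ∈ regularPart Ω P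

/-- The open vertical cylinder. -/
def openCylinder (p : ℝ × ℝ) (z₀ ρ : ℝ) : Set R3 :=
  {x | (x 0 - p.1) ^ 2 + (x 1 - p.2) ^ 2 < ρ ^ 2 ∧ |x 2 - z₀| < ρ}

lemma isOpen_openCylinder (p : ℝ × ℝ) (z₀ ρ : ℝ) : IsOpen (openCylinder p z₀ ρ) :=
  (isOpen_lt (by fun_prop : Continuous fun x : R3 => (x 0 - p.1) ^ 2 + (x 1 - p.2) ^ 2)
    continuous_const).inter (isOpen_lt (by fun_prop : Continuous fun x : R3 => |x 2 - z₀|)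
      continuous_const)

lemma exists_cylinder_subset {U : Set R3} (hU : IsOpen U) {x : R3} (hx : x ∈ U) :
    ∃ δ > 0, ∀ ρ, 0 < ρ → ρ ≤ δ → ∀ q ∈ disc (x 0, x 1) ρ, ∀ z, |z - x 2| ≤ ρ → pt q z ∈ U := by
  obtain ⟨ε, hε, h⟩ := Metric.isOpen_iff.1 hU x hx
  refine ⟨ε / 2, by positivity, fun ρ h0 hρ q hq z hz => h ?_⟩
  have hq' : (q.1 - x 0) ^ 2 + (q.2 - x 1) ^ 2 ≤ ρ ^ 2 := hq
  have hz' : (z - x 2) ^ 2 ≤ ρ ^ 2 := sq_le_sq' (abs_le.1 hz).1 (abs_le.1 hz).2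
  rw [Metric.mem_ball, EuclideanSpace.dist_eq, Fin.sum_univ_three, sqrt_lt' hε]
  simp only [dist_eq, sq_abs, pt_zero, pt_one, pt_two]
  nlinarith

lemma toR2_injective : Function.Injective toR2 := by
  intro q q' h
  have h0 := congrArg (fun v : R2 => v 0) h
  have h1 := congrArg (fun v : R2 => v 1) h
  exact Prod.ext h0 h1

variable {Ω : Opens R3} {P : Set R2} {C : Loops}

/-- For a point on a line, the larger disc is the one bounded by the chosen circle, whose height may
differ from that of the point. Since the lines are vertical, the absence of other lines in that disc
clears the whole column above it; taking `ρ` at most half the radius gives `ρ < r`. For a point off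
the lines, openness of the regular part provides a cylinder free of lines, with the larger disc at
the height of the point. -/
lemma exists_isCylinder (hopen : IsOpen (regularPart Ω P))
    (hC : ∀ p ∈ P, Encircles Ω P p (C.height p) (C.radius p)) {x : R3} (hx : x ∈ Ω) :
    ∃ p z₀ zs r ρ, IsCylinder Ω P C p z₀ zs r ρ ∧ x ∈ openCylinder p z₀ ρ := by
  have hmem : ∀ ρ, 0 < ρ → x ∈ openCylinder (x 0, x 1) (x 2) ρ := fun ρ h => by
    simp [openCylinder, h]
  by_cases hP : planar x ∈ P
  · obtain ⟨hr, hdisc⟩ := hC _ hP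
    obtain ⟨δ, hδ, h⟩ := exists_cylinder_subset Ω.isOpen hx
    have h0 : 0 < min δ (C.radius (planar x) / 2) := by positivity
    refine ⟨(x 0, x 1), x 2, C.height (planar x), C.radius (planar x),
      min δ (C.radius (planar x) / 2), ⟨h0, ?_, h _ h0 (min_le_left _ _), ?_, fun _ => ⟨rfl, rfl⟩,
        fun hn => absurd hP hn⟩, hmem _ h0⟩
    · exact (min_le_right _ _).trans_lt (by linarith)
    · intro q hq hne
      have hd : dist (toR2 q) (planar x) ≤ C.radius (planar x) := by
        rw [EuclideanSpace.dist_eq, Fin.sum_univ_two, sqrt_le_left hr.le]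
        simp only [dist_eq, sq_abs]
        exact hq
      obtain ⟨h1, h2⟩ := hdisc _ hd
      exact ⟨h1, fun hm => hne (toR2_injective (h2 hm))⟩
  · have hreg : x ∈ regularPart Ω P := ⟨hx, hP⟩
    obtain ⟨δ, hδ, h⟩ := exists_cylinder_subset hopen hreg
    have h2 : 0 < δ / 2 := by positivity
    refine ⟨(x 0, x 1), x 2, x 2, δ, δ / 2, ⟨h2, by linarith, fun q hq z hz =>
      (h _ h2 (by linarith) q hq z hz).1, fun q hq _ => h δ hδ le_rfl q hq _ (by simp [hδ.le]),
      fun hm => absurd hm hP, fun _ => by rw [pt_eta]; exact hreg⟩, hmem _ h2⟩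

end Cylinders

/-! ### Horizontal slices of the strain and compatibility in the plane. -/

section Slices

open Real Filter Topology

/-- The horizontal slice of a component of the strain. -/
def slice (E : Fin 3 → Fin 3 → R3 → ℝ) (zs : ℝ) (i j : Fin 3) (q : ℝ × ℝ) : ℝ := E i j (pt q zs)

variable {Ω : Opens R3} {P : Set R2} {E : Fin 3 → Fin 3 → R3 → ℝ} {zs : ℝ} {q : ℝ × ℝ}

lemma contDiffAt_strain (hopen : IsOpen (regularPart Ω P)) (hE : IsStrain Ω P E) (i j : Fin 3)
    {x : R3} (hx : x ∈ regularPart Ω P) : ContDiffAt ℝ 2 (E i j) x :=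
  contDiffAt_infty.1 ((hE.smooth i j).contDiffAt (hopen.mem_nhds hx)) 2

lemma contDiff_pt_left (z : ℝ) {n : WithTop ℕ∞} : ContDiff ℝ n fun q : ℝ × ℝ => pt q z :=
  contDiff_pt.comp (contDiff_id.prodMk contDiff_const)

lemma eventually_regular (hopen : IsOpen (regularPart Ω P)) (hq : pt q zs ∈ regularPart Ω P) :
    ∀ᶠ y in 𝓝 q, pt y zs ∈ regularPart Ω P :=
  (contDiff_pt_left zs (n := 0)).continuous.continuousAt.eventually (hopen.mem_nhds hq)

lemma contDiffAt_slice (hopen : IsOpen (regularPart Ω P)) (hE : IsStrain Ω P E) (i j : Fin 3)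
    (hq : pt q zs ∈ regularPart Ω P) : ContDiffAt ℝ 2 (slice E zs i j) q :=
  (contDiffAt_strain hopen hE i j hq).comp q (contDiff_pt_left zs).contDiffAt

lemma slice_symm (hopen : IsOpen (regularPart Ω P)) (hE : IsStrain Ω P E) (i j : Fin 3)
    (hq : pt q zs ∈ regularPart Ω P) : slice E zs i j =ᶠ[𝓝 q] slice E zs j i := by
  filter_upwards [eventually_regular hopen hq] with y hy using hE.symm i j _ hy

lemma dd_slice (hopen : IsOpen (regularPart Ω P)) (hE : IsStrain Ω P E) (i j : Fin 3)
    (hq : pt q zs ∈ regularPart Ω P) :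
    Dx (slice E zs i j) q = pd 0 (E i j) (pt q zs) ∧
      Dy (slice E zs i j) q = pd 1 (E i j) (pt q zs) :=
  dd_comp_pt ((contDiffAt_strain hopen hE i j hq).differentiableAt (by norm_num))

lemma dd_dd_slice (hopen : IsOpen (regularPart Ω P)) (hE : IsStrain Ω P E) (i j : Fin 3)
    (hq : pt q zs ∈ regularPart Ω P) :
    Dx (Dx (slice E zs i j)) q = pd 0 (pd 0 (E i j)) (pt q zs) ∧
    Dx (Dy (slice E zs i j)) q = pd 0 (pd 1 (E i j)) (pt q zs) ∧
    Dy (Dx (slice E zs i j)) q = pd 1 (pd 0 (E i j)) (pt q zs) ∧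
    Dy (Dy (slice E zs i j)) q = pd 1 (pd 1 (E i j)) (pt q zs) := by
  have h0 : Dx (slice E zs i j) =ᶠ[𝓝 q] fun y => pd 0 (E i j) (pt y zs) := by
    filter_upwards [eventually_regular hopen hq] with y hy using (dd_slice hopen hE i j hy).1
  have h1 : Dy (slice E zs i j) =ᶠ[𝓝 q] fun y => pd 1 (E i j) (pt y zs) := by
    filter_upwards [eventually_regular hopen hq] with y hy using (dd_slice hopen hE i j hy).2
  have hd : ∀ k, DifferentiableAt ℝ (pd k (E i j)) (pt q zs) := fun k =>
    (contDiffAt_dd (contDiffAt_strain hopen hE i j hq) (m := 1) (by norm_num) (e k)).differentiableAt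
      (by norm_num)
  rw [dd_congr h0, dd_congr h1, dd_congr h0, dd_congr h1]
  exact ⟨(dd_comp_pt (hd 0)).1, (dd_comp_pt (hd 1)).1, (dd_comp_pt (hd 0)).2, (dd_comp_pt (hd 1)).2⟩

lemma compatibleAt_slice (hopen : IsOpen (regularPart Ω P)) (hE : IsStrain Ω P E)
    (hq : pt q zs ∈ regularPart Ω P) :
    CompatibleAt (slice E zs 0 0) (slice E zs 0 1) (slice E zs 1 1) q := by
  refine ⟨contDiffAt_slice hopen hE _ _ hq, contDiffAt_slice hopen hE _ _ hq,
    contDiffAt_slice hopen hE _ _ hq, ?_⟩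
  obtain ⟨K, a, b, h⟩ := hE.compatible
  have h1 := (h _ hq).1
  have h2 : Dx (Dy (slice E zs 1 0)) q = Dx (Dy (slice E zs 0 1)) q :=
    dd_congr (dd_eventuallyEq (slice_symm hopen hE 1 0 hq))
  have h3 := dd_comm (contDiffAt_slice hopen hE 0 1 hq) (1, 0) (0, 1)
  rw [(dd_dd_slice hopen hE 1 0 hq).2.1, (dd_dd_slice hopen hE 0 1 hq).2.1] at h2
  rw [(dd_dd_slice hopen hE 0 1 hq).2.1, (dd_dd_slice hopen hE 0 1 hq).2.2.1] at h3
  rw [(dd_dd_slice hopen hE 1 1 hq).1, (dd_dd_slice hopen hE 0 1 hq).2.1,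
    (dd_dd_slice hopen hE 0 0 hq).2.2.2]
  simp [Fin.sum_univ_two, eps2, eps3, lat] at h1
  linarith

lemma curl_slice (hopen : IsOpen (regularPart Ω P)) (hE : IsStrain Ω P E) {K : ℝ}
    (hK : ∀ x ∈ regularPart Ω P,
      ∑ α : Fin 2, ∑ β : Fin 2, eps2 α β * pd (lat α) (E (lat β) 2) x = K)
    (hq : pt q zs ∈ regularPart Ω P) :
    Dx (slice E zs 1 2) q - Dy (slice E zs 0 2) q = K := by
  rw [(dd_slice hopen hE 1 2 hq).1, (dd_slice hopen hE 0 2 hq).2, ← hK _ hq]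
  simp [Fin.sum_univ_two, eps2, eps3, lat]
  ring

lemma pd_two_strain (hopen : IsOpen (regularPart Ω P)) (hE : IsStrain Ω P E) (i j : Fin 3)
    (hq : pt q zs ∈ regularPart Ω P) : pd 2 (E i j) (pt q zs) = 0 := by
  have h1 := hasDerivAt_comp_pt
    ((contDiffAt_strain hopen hE i j hq).differentiableAt (by norm_num))
  have hc : ContinuousAt (fun z => pt q z) zs :=
    ((contDiff_pt (n := 0)).continuous.comp (Continuous.prodMk_right q)).continuousAt
  have h2 : (fun z => E i j (pt q z)) =ᶠ[𝓝 zs] fun _ => E i j (pt q zs) := by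
    filter_upwards [hc.eventually (hopen.mem_nhds hq)] with z hz
    exact hE.vertical i j _ hz _ hq rfl
  exact h1.unique ((hasDerivAt_const zs _).congr_of_eventuallyEq h2)

/-- The Frank tensor in terms of horizontal slices of the strain. -/
lemma frankField_slice (hopen : IsOpen (regularPart Ω P)) (hE : IsStrain Ω P E) (l : Fin 3)
    (hq : pt q zs ∈ regularPart Ω P) :
    frankField E l 0 (pt q zs) = Dy (slice E zs l 2) q ∧
    frankField E l 1 (pt q zs) = -Dx (slice E zs l 2) q ∧
    frankField E l 2 (pt q zs) = Dx (slice E zs l 1) q - Dy (slice E zs l 0) q := by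
  rw [dd_congr (slice_symm hopen hE l 2 hq), dd_congr (slice_symm hopen hE l 2 hq),
    dd_congr (slice_symm hopen hE l 1 hq), dd_congr (slice_symm hopen hE l 0 hq),
    (dd_slice hopen hE 2 l hq).1, (dd_slice hopen hE 2 l hq).2,
    (dd_slice hopen hE 1 l hq).1, (dd_slice hopen hE 0 l hq).2]
  have h := fun i => pd_two_strain hopen hE i l hq
  refine ⟨?_, ?_, ?_⟩ <;> (simp [frankField, Fin.sum_univ_three, eps3, h]; try ring)

end Slices

/-! ### Circulations of one-forms of constant curl. -/

section JumpVectors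

open Real Filter Topology

lemma loopIntegral_circleLoop (w : Fin 3 → R3 → ℝ) (p : ℝ × ℝ) (z r : ℝ) :
    loopIntegral w (circleLoop (toR2 p) z r) =
      loop p r (fun q => w 0 (pt q z)) (fun q => w 1 (pt q z)) := by
  have h0 : ∀ t, deriv (fun s => circleLoop (toR2 p) z r s 0) t = -(r * sin t) := fun t => by
    have := (((hasDerivAt_cos t).const_mul r).const_add p.1).deriv
    rw [mul_neg] at this
    exact this
  have h1 : ∀ t, deriv (fun s => circleLoop (toR2 p) z r s 1) t = r * cos t := fun t =>
    (((hasDerivAt_sin t).const_mul r).const_add p.2).deriv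
  have h2 : ∀ t, deriv (fun s => circleLoop (toR2 p) z r s 2) t = 0 := fun t =>
    deriv_const t z
  unfold loopIntegral loop
  simp only [Fin.sum_univ_three, h0, h1, h2, mul_zero, add_zero]
  rfl

variable {p : ℝ × ℝ} {r : ℝ}

lemma loop_add_const_mul {a b a' b' : ℝ × ℝ → ℝ} (c : ℝ)
    (ha : Continuous fun t => a (circ p r t)) (hb : Continuous fun t => b (circ p r t))
    (ha' : Continuous fun t => a' (circ p r t)) (hb' : Continuous fun t => b' (circ p r t)) :
    loop p r (fun q => a q + c * a' q) (fun q => b q + c * b' q) =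
      loop p r a b + c * loop p r a' b' := by
  rw [loop_add ha hb (ha'.const_mul c) (hb'.const_mul c), loop_const_mul]

lemma continuous_circ_right (p : ℝ × ℝ) (r : ℝ) : Continuous (circ p r) :=
  (continuous_circ p).comp (Continuous.prodMk_right r)

section OneForm

variable {a b : ℝ × ℝ → ℝ} {K : ℝ}

lemma hasFDerivAt_coord (q : ℝ × ℝ) :
    HasFDerivAt (fun q : ℝ × ℝ => q.1) (ContinuousLinearMap.fst ℝ ℝ ℝ) q ∧
    HasFDerivAt (fun q : ℝ × ℝ => q.2) (ContinuousLinearMap.snd ℝ ℝ ℝ) q :=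
  ⟨hasFDerivAt_fst, hasFDerivAt_snd⟩

/-- The derivative in `x` of a one-form of constant curl integrates to zero along a circle. -/
lemma loop_dx_eq_zero (ha : ∀ t, ContDiffAt ℝ 2 a (circ p r t))
    (hK : ∀ t, Dx b (circ p r t) - Dy a (circ p r t) = K) :
    loop p r (Dx a) (Dx b) = 0 := by
  -- Since `∂_x b = ∂_y a + K`, the form `∂_x a dx + ∂_x b dy` is the differential of `a + K y`.
  have hd : ∀ t, HasFDerivAt (fun q => a q + K * q.2) _ (circ p r t) := fun t =>
    ((ha t).differentiableAt (by norm_num)).hasFDerivAt.add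
      ((hasFDerivAt_coord _).2.const_mul K)
  refine Eq.trans (loop_congr fun t => ⟨?_, ?_⟩) (loop_exact (p := p) (r := r)
    (f := fun q => a q + K * q.2) fun t => ((ha t).of_le (by norm_num)).add (by fun_prop))
  · rw [dd, dd, (hd t).fderiv]; simp
  · rw [eq_add_of_sub_eq (hK t)]
    rw [dd, dd, (hd t).fderiv]; simp [add_comm]

/-- The derivative in `y` of a one-form of constant curl integrates to zero along a circle. -/
lemma loop_dy_eq_zero (hb : ∀ t, ContDiffAt ℝ 2 b (circ p r t))
    (hK : ∀ t, Dx b (circ p r t) - Dy a (circ p r t) = K) :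
    loop p r (Dy a) (Dy b) = 0 := by
  -- Likewise `∂_y a = ∂_x b - K` makes the form the differential of `b - K x`.
  have hd : ∀ t, HasFDerivAt (fun q => b q - K * q.1) _ (circ p r t) := fun t =>
    ((hb t).differentiableAt (by norm_num)).hasFDerivAt.sub
      ((hasFDerivAt_coord _).1.const_mul K)
  refine Eq.trans (loop_congr fun t => ⟨?_, ?_⟩) (loop_exact (p := p) (r := r)
    (f := fun q => b q - K * q.1) fun t => ((hb t).of_le (by norm_num)).sub (by fun_prop))
  · have h := hK t
    have : Dy a (circ p r t) = Dx b (circ p r t) - K := by linarith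
    rw [this]
    rw [dd, dd, (hd t).fderiv]; simp
  · rw [dd, dd, (hd t).fderiv]; simp

/-- Integration by parts along the circle: moving the derivative off `a` and `b` onto the
coordinates yields a second copy of the form, hence the factor 2. It explains the coefficient `1/2`
of `α_z` in the contortion, and the result no longer depends on `x₀`, `y₀`. -/
lemma loop_vertical_burgers (ha : ∀ t, ContDiffAt ℝ 2 a (circ p r t))
    (hb : ∀ t, ContDiffAt ℝ 2 b (circ p r t))
    (hK : ∀ t, Dx b (circ p r t) - Dy a (circ p r t) = K) (x₀ y₀ : ℝ) :
    loop p r (fun q => a q - (q.1 - x₀) * Dx a q - (q.2 - y₀) * Dy a q)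
        (fun q => b q - (q.1 - x₀) * Dx b q - (q.2 - y₀) * Dy b q) =
      2 * loop p r a (fun q => b q - K * (q.1 - p.1)) := by
  have hc := continuous_circ_right p r
  have hac : Continuous fun t => a (circ p r t) :=
    continuous_comp_circ fun t => (ha t).of_le (by norm_num)
  have hbc : Continuous fun t => b (circ p r t) :=
    continuous_comp_circ fun t => (hb t).of_le (by norm_num)
  -- The primitive of the difference of the two forms. For `K = 0` it is `-(x - x₀) a - (y - y₀) b`;
  -- the polynomial absorbs the constant curl and the correction `K (x - p.1)` on the right.
  set f : ℝ × ℝ → ℝ := fun q => K * (q.1 * q.2) - K * y₀ * q.1 - K * (2 * p.1 - x₀) * q.2 -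
    (q.1 - x₀) * a q - (q.2 - y₀) * b q with hf
  have hd : ∀ t, HasFDerivAt f _ (circ p r t) := fun t =>
    let hx := (hasFDerivAt_coord (circ p r t)).1
    let hy := (hasFDerivAt_coord (circ p r t)).2
    (((((hx.mul hy).const_mul K).sub (hx.const_mul (K * y₀))).sub
      (hy.const_mul (K * (2 * p.1 - x₀)))).sub
      ((hx.sub_const x₀).mul ((ha t).differentiableAt (by norm_num)).hasFDerivAt)).sub
      ((hy.sub_const y₀).mul ((hb t).differentiableAt (by norm_num)).hasFDerivAt)
  have hfd : ∀ t, ContDiffAt ℝ 1 f (circ p r t) := fun t => by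
    have h1 : ContDiffAt ℝ 1 a (circ p r t) := (ha t).of_le (by norm_num)
    have h2 : ContDiffAt ℝ 1 b (circ p r t) := (hb t).of_le (by norm_num)
    have h3 : ContDiffAt ℝ 1 (fun q : ℝ × ℝ => q.1) (circ p r t) := contDiffAt_fst
    have h4 : ContDiffAt ℝ 1 (fun q : ℝ × ℝ => q.2) (circ p r t) := contDiffAt_snd
    exact ((((contDiffAt_const.mul (h3.mul h4)).sub (contDiffAt_const.mul h3)).sub
      (contDiffAt_const.mul h4)).sub ((h3.sub contDiffAt_const).mul h1)).sub
      ((h4.sub contDiffAt_const).mul h2)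
  have hc2 : Continuous fun t => b (circ p r t) - K * ((circ p r t).1 - p.1) :=
    hbc.sub (continuous_const.mul (hc.fst.sub continuous_const))
  have key := loop_add_exact (a := fun q => 2 * a q) (b := fun q => 2 * (b q - K * (q.1 - p.1)))
    hfd (continuous_const.mul hac) (continuous_const.mul hc2)
  rw [← loop_const_mul, ← key]
  refine loop_congr fun t => ?_
  have h := hK t
  constructor
  · have e : Dx f (circ p r t) = K * (circ p r t).2 - K * y₀ -
        (a (circ p r t) + ((circ p r t).1 - x₀) * Dx a (circ p r t)) -
        ((circ p r t).2 - y₀) * Dx b (circ p r t) := by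
      simp only [dd, (hd t).fderiv]
      simp
      ring
    rw [e]
    linear_combination ((circ p r t).2 - y₀) * h
  · have e : Dy f (circ p r t) = K * (circ p r t).1 - K * (2 * p.1 - x₀) -
        ((circ p r t).1 - x₀) * Dy a (circ p r t) -
        (b (circ p r t) + ((circ p r t).2 - y₀) * Dy b (circ p r t)) := by
      simp only [dd, (hd t).fderiv]
      simp
      ring
    rw [e]
    linear_combination -((circ p r t).1 - x₀) * h

end OneForm

end JumpVectors

/-! ### Frank and Burgers vectors as circulation and moments. -/

section JumpVectors

open Real Filter Topology

variable (E : Fin 3 → Fin 3 → R3 → ℝ) (zs : ℝ) (p : ℝ × ℝ) (r : ℝ)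

/-- The component along `x` of the gradient of the rotation about the vertical axis. -/
def rotX (q : ℝ × ℝ) : ℝ := Dx (slice E zs 0 1) q - Dy (slice E zs 0 0) q

/-- The component along `y` of the gradient of the rotation about the vertical axis. -/
def rotY (q : ℝ × ℝ) : ℝ := Dx (slice E zs 1 1) q - Dy (slice E zs 0 1) q

/-- The jump of the rotation about the vertical axis. -/
def frankJump : ℝ := loop p r (rotX E zs) (rotY E zs)

/-- The first moment of the jump in the direction `x`. -/
def momentX : ℝ := loop p r (fun q => (q.1 - p.1) * rotX E zs q - slice E zs 0 1 q)
  (fun q => (q.1 - p.1) * rotY E zs q - slice E zs 1 1 q)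

/-- The first moment of the jump in the direction `y`. -/
def momentY : ℝ := loop p r (fun q => (q.2 - p.2) * rotX E zs q + slice E zs 0 0 q)
  (fun q => (q.2 - p.2) * rotY E zs q + slice E zs 0 1 q)

/-- The jump of the shear strain, corrected by its constant curl `K`. -/
def shearJump (K : ℝ) : ℝ :=
  loop p r (slice E zs 0 2) (fun q => slice E zs 1 2 q - K * (q.1 - p.1))

variable {E zs p r} {Ω : Opens R3} {P : Set R2}

lemma continuous_slice_circ (hopen : IsOpen (regularPart Ω P)) (hE : IsStrain Ω P E)
    (hreg : ∀ t, pt (circ p r t) zs ∈ regularPart Ω P) (i j : Fin 3) :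
    Continuous fun t => slice E zs i j (circ p r t) :=
  continuous_comp_circ fun t => (contDiffAt_slice hopen hE i j (hreg t)).of_le (by norm_num)

lemma continuous_rot_circ (hopen : IsOpen (regularPart Ω P)) (hE : IsStrain Ω P E)
    (hreg : ∀ t, pt (circ p r t) zs ∈ regularPart Ω P) :
    (Continuous fun t => rotX E zs (circ p r t)) ∧ Continuous fun t => rotY E zs (circ p r t) := by
  have h := fun (i j : Fin 3) (v : ℝ × ℝ) => continuous_dd_circ (p := p) (r := r)
    (f := slice E zs i j)
    (fun t => (contDiffAt_slice hopen hE i j (hreg t)).of_le (by norm_num)) v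
  exact ⟨(h 0 1 _).sub (h 0 0 _), (h 1 1 _).sub (h 0 1 _)⟩

/-- The loop integral of an affine multiple of the Frank form in terms of the moments. -/
lemma loop_affinePart (hopen : IsOpen (regularPart Ω P)) (hE : IsStrain Ω P E)
    (hreg : ∀ t, pt (circ p r t) zs ∈ regularPart Ω P) (g : ℝ × ℝ → ℝ) :
    loop p r
      (fun q => affinePart g p q * (Dx (slice E zs 0 1) q - Dy (slice E zs 0 0) q) -
        (Dx g p * slice E zs 0 1 q - Dy g p * slice E zs 0 0 q))
      (fun q => affinePart g p q * (Dx (slice E zs 1 1) q - Dy (slice E zs 0 1) q) -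
        (Dx g p * slice E zs 1 1 q - Dy g p * slice E zs 0 1 q)) =
      g p * frankJump E zs p r + Dx g p * momentX E zs p r + Dy g p * momentY E zs p r := by
  obtain ⟨c1, c2⟩ := continuous_rot_circ hopen hE hreg
  have cs := continuous_slice_circ hopen hE hreg
  have hx : Continuous fun t => (circ p r t).1 - p.1 :=
    (continuous_circ_right p r).fst.sub continuous_const
  have hy : Continuous fun t => (circ p r t).2 - p.2 :=
    (continuous_circ_right p r).snd.sub continuous_const
  have m1 := (hx.mul c1).sub (cs 0 1)
  have m2 := (hx.mul c2).sub (cs 1 1)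
  have n1 := (hy.mul c1).add (cs 0 0)
  have n2 := (hy.mul c2).add (cs 0 1)
  rw [frankJump, momentX, momentY, ← loop_const_mul,
    ← loop_add_const_mul _ (continuous_const.mul c1) (continuous_const.mul c2) m1 m2,
    ← loop_add_const_mul _ ((continuous_const.mul c1).add (continuous_const.mul m1))
      ((continuous_const.mul c2).add (continuous_const.mul m2)) n1 n2]
  refine loop_congr fun t => ?_
  have h : ∀ q : ℝ × ℝ, affinePart g p q = g p + ((q.1 - p.1) * Dx g p + (q.2 - p.2) * Dy g p) := by
    intro q
    rw [affinePart, show q - p = (q.1 - p.1, q.2 - p.2) from rfl, fderiv_apply_prod]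
  simp only [h, rotX, rotY]
  constructor <;> ring

/-- The jumps vanish around a disc on which the strain is regular. -/
lemma jumps_eq_zero (hopen : IsOpen (regularPart Ω P)) (hE : IsStrain Ω P E) {K : ℝ}
    (hK : ∀ x ∈ regularPart Ω P,
      ∑ α : Fin 2, ∑ β : Fin 2, eps2 α β * pd (lat α) (E (lat β) 2) x = K)
    (hr : 0 ≤ r) (hreg : ∀ q ∈ disc p r, pt q zs ∈ regularPart Ω P) :
    frankJump E zs p r = 0 ∧ momentX E zs p r = 0 ∧ momentY E zs p r = 0 ∧
      shearJump E zs p r K = 0 := by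
  have hcomp : ∀ q ∈ disc p r,
      CompatibleAt (slice E zs 0 0) (slice E zs 0 1) (slice E zs 1 1) q :=
    fun q hq => compatibleAt_slice hopen hE (hreg q hq)
  have d1 : ∀ (c : ℝ) (v : ℝ × ℝ), dd v (fun _ : ℝ × ℝ => c) = fun _ => 0 := fun c v =>
    funext fun q => dd_const v c q
  have dx : ∀ v : ℝ × ℝ, dd v (fun q : ℝ × ℝ => q.1 - p.1) = fun _ => v.1 := fun v =>
    funext fun q => by
      rw [dd, ((hasFDerivAt_coord q).1.sub_const p.1).fderiv]; rfl
  have dy : ∀ v : ℝ × ℝ, dd v (fun q : ℝ × ℝ => q.2 - p.2) = fun _ => v.2 := fun v =>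
    funext fun q => by
      rw [dd, ((hasFDerivAt_coord q).2.sub_const p.2).fderiv]; rfl
  refine ⟨?_, ?_, ?_, ?_⟩
  -- The first three jumps are the boundary terms of Green's formula for the multipliers `1`, `x -
  -- p.1` and `y - p.2`, whose second derivatives vanish.
  · have := loop_incompatibility hr (H := fun _ => 1) contDiff_const fun q hq _ => hcomp q hq
    simp only [d1, zero_mul, mul_zero, sub_zero, add_zero, neg_zero, one_mul,
      intervalIntegral.integral_zero] at this
    exact this
  · have := loop_incompatibility hr (H := fun q : ℝ × ℝ => q.1 - p.1) (by fun_prop)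
      fun q hq _ => hcomp q hq
    simp only [d1, dx, zero_mul, mul_zero, sub_zero, add_zero, neg_zero, one_mul,
      intervalIntegral.integral_zero] at this
    exact this
  · have := loop_incompatibility hr (H := fun q : ℝ × ℝ => q.2 - p.2) (by fun_prop)
      fun q hq _ => hcomp q hq
    simp only [d1, dy, zero_mul, mul_zero, sub_zero, zero_sub, sub_neg_eq_add, add_zero, neg_zero,
      one_mul, intervalIntegral.integral_zero] at this
    exact this
  · have := loop_mul_eq_integral_polar (K := 0) hr (H := fun _ => 1) (a := slice E zs 0 2)
      (b := fun q => slice E zs 1 2 q - K * (q.1 - p.1)) contDiff_const fun q hq _ => by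
        have h2 := (contDiffAt_slice hopen hE 1 2 (hreg q hq)).of_le (m := 1) (by norm_num)
        have h3 : ContDiffAt ℝ 1 (fun q : ℝ × ℝ => K * (q.1 - p.1)) q := by fun_prop
        refine ⟨(contDiffAt_slice hopen hE 0 2 (hreg q hq)).of_le (by norm_num), h2.sub h3, ?_⟩
        rw [dd_sub (h2.differentiableAt (by norm_num)) (h3.differentiableAt (by norm_num)),
          dd_const_mul _ _ (by fun_prop), dx, ← curl_slice hopen hE hK (hreg q hq)]
        ring
    simp only [d1, zero_mul, mul_zero, sub_zero, add_zero, one_mul,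
      intervalIntegral.integral_zero] at this
    exact this

variable {C : Loops} {x₀ : R3}

lemma frankVector_eq (hopen : IsOpen (regularPart Ω P)) (hE : IsStrain Ω P E)
    (hreg : ∀ t, pt (circ p r t) zs ∈ regularPart Ω P)
    (hC : C.height (toR2 p) = zs ∧ C.radius (toR2 p) = r) :
    frankVector E C 2 (toR2 p) = frankJump E zs p r := by
  rw [frankVector, hC.1, hC.2, loopIntegral_circleLoop]
  refine loop_congr fun t => ⟨?_, ?_⟩
  · rw [(frankField_slice hopen hE 0 (hreg t)).2.2, rotX]
  · rw [(frankField_slice hopen hE 1 (hreg t)).2.2, rotY,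
      dd_congr (slice_symm hopen hE 1 0 (hreg t))]

lemma slice_symm_apply (hE : IsStrain Ω P E) (i j : Fin 3) {q : ℝ × ℝ}
    (hq : pt q zs ∈ regularPart Ω P) : slice E zs i j q = slice E zs j i q :=
  hE.symm i j _ hq

lemma burgersField_slice (hopen : IsOpen (regularPart Ω P)) (hE : IsStrain Ω P E) (l : Fin 3)
    {q : ℝ × ℝ} (hq : pt q zs ∈ regularPart Ω P) :
    burgersField E x₀ l 0 (pt q zs) = slice E zs 0 l q +
      (q.2 - x₀ 1) * (Dx (slice E zs l 1) q - Dy (slice E zs l 0) q) +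
      (zs - x₀ 2) * Dx (slice E zs l 2) q ∧
    burgersField E x₀ l 1 (pt q zs) = slice E zs 1 l q -
      (q.1 - x₀ 0) * (Dx (slice E zs l 1) q - Dy (slice E zs l 0) q) +
      (zs - x₀ 2) * Dy (slice E zs l 2) q ∧
    burgersField E x₀ l 2 (pt q zs) = slice E zs l 2 q -
      (q.1 - x₀ 0) * Dx (slice E zs l 2) q - (q.2 - x₀ 1) * Dy (slice E zs l 2) q := by
  obtain ⟨f0, f1, f2⟩ := frankField_slice hopen hE l hq
  have h2 : slice E zs l 2 q = E 2 l (pt q zs) := slice_symm_apply hE l 2 hq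
  rw [h2]
  simp only [burgersField, Fin.sum_univ_three, f0, f1, f2]
  refine ⟨?_, ?_, ?_⟩ <;> (simp [eps3, slice]; try ring)

/-- Writing `x_β - x_{0β}` as `(x_β - p_β) + (p_β - x_{0β})` splits each planar component into a
first moment about the line and a multiple of the Frank vector, the one that the definition of `α`
takes away. The term in `zs - x₀ 2` is a derivative of a one-form of constant curl and integrates to
zero. The vertical component is `loop_vertical_burgers`. -/
lemma burgersVector_eq (hopen : IsOpen (regularPart Ω P)) (hE : IsStrain Ω P E) {K : ℝ}
    (hK : ∀ x ∈ regularPart Ω P,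
      ∑ α : Fin 2, ∑ β : Fin 2, eps2 α β * pd (lat α) (E (lat β) 2) x = K)
    (hreg : ∀ t, pt (circ p r t) zs ∈ regularPart Ω P)
    (hC : C.height (toR2 p) = zs ∧ C.radius (toR2 p) = r) :
    burgersVector E x₀ C 0 (toR2 p) - frankJump E zs p r * (p.2 - x₀ 1) = momentY E zs p r ∧
    burgersVector E x₀ C 1 (toR2 p) + frankJump E zs p r * (p.1 - x₀ 0) = -momentX E zs p r ∧
    burgersVector E x₀ C 2 (toR2 p) = 2 * shearJump E zs p r K := by
  obtain ⟨c1, c2⟩ := continuous_rot_circ hopen hE hreg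
  have cs := continuous_slice_circ hopen hE hreg
  have hx : Continuous fun t => (circ p r t).1 - p.1 :=
    (continuous_circ_right p r).fst.sub continuous_const
  have hy : Continuous fun t => (circ p r t).2 - p.2 :=
    (continuous_circ_right p r).snd.sub continuous_const
  have ha : ∀ t, ContDiffAt ℝ 2 (slice E zs 0 2) (circ p r t) := fun t =>
    contDiffAt_slice hopen hE 0 2 (hreg t)
  have hb : ∀ t, ContDiffAt ℝ 2 (slice E zs 1 2) (circ p r t) := fun t =>
    contDiffAt_slice hopen hE 1 2 (hreg t)
  have hk := fun t => curl_slice hopen hE hK (hreg t)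
  have cd : ∀ {f : ℝ × ℝ → ℝ}, (∀ t, ContDiffAt ℝ 2 f (circ p r t)) → ∀ v : ℝ × ℝ,
      Continuous fun t => dd v f (circ p r t) := fun hf v =>
    continuous_dd_circ (fun t => (hf t).of_le (by norm_num)) v
  have hs := fun t => slice_symm_apply hE (zs := zs) 1 0 (hreg t)
  have hds := fun t v => dd_congr (a := v) (slice_symm hopen hE 1 0 (hreg t))
  refine ⟨?_, ?_, ?_⟩
  · have n1 := (hy.mul c1).add (cs 0 0)
    have n2 := (hy.mul c2).add (cs 0 1)
    have h1 := loop_add_const_mul (p := p) (r := r)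
      (a := fun q => (q.2 - p.2) * rotX E zs q + slice E zs 0 0 q)
      (b := fun q => (q.2 - p.2) * rotY E zs q + slice E zs 0 1 q)
      (a' := rotX E zs) (b' := rotY E zs) (p.2 - x₀ 1) n1 n2 c1 c2
    have h2 := loop_add_const_mul (p := p) (r := r)
      (a := fun q => (q.2 - p.2) * rotX E zs q + slice E zs 0 0 q + (p.2 - x₀ 1) * rotX E zs q)
      (b := fun q => (q.2 - p.2) * rotY E zs q + slice E zs 0 1 q + (p.2 - x₀ 1) * rotY E zs q)
      (a' := Dx (slice E zs 0 2)) (b' := Dx (slice E zs 1 2)) (zs - x₀ 2)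
      (n1.add (c1.const_mul (p.2 - x₀ 1))) (n2.add (c2.const_mul (p.2 - x₀ 1)))
      (cd ha (1, 0)) (cd hb (1, 0))
    rw [h1, loop_dx_eq_zero ha hk] at h2
    have h3 : burgersVector E x₀ C 0 (toR2 p) = _ := Eq.trans (by
      rw [burgersVector, hC.1, hC.2, loopIntegral_circleLoop]
      refine loop_congr fun t => ⟨?_, ?_⟩
      · rw [(burgersField_slice hopen hE 0 (hreg t)).1]
        simp only [rotX]
        ring
      · rw [(burgersField_slice hopen hE 1 (hreg t)).1, hds]
        simp only [rotY]
        ring) h2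
    rw [h3, momentY, frankJump]
    ring
  · have n1 := ((hx.mul c1).sub (cs 0 1)).const_mul (-1)
    have n2 := ((hx.mul c2).sub (cs 1 1)).const_mul (-1)
    have h1 := loop_add_const_mul (p := p) (r := r)
      (a := fun q => -1 * ((q.1 - p.1) * rotX E zs q - slice E zs 0 1 q))
      (b := fun q => -1 * ((q.1 - p.1) * rotY E zs q - slice E zs 1 1 q))
      (a' := rotX E zs) (b' := rotY E zs) (-(p.1 - x₀ 0)) n1 n2 c1 c2
    have h2 := loop_add_const_mul (p := p) (r := r)
      (a := fun q => -1 * ((q.1 - p.1) * rotX E zs q - slice E zs 0 1 q) +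
        -(p.1 - x₀ 0) * rotX E zs q)
      (b := fun q => -1 * ((q.1 - p.1) * rotY E zs q - slice E zs 1 1 q) +
        -(p.1 - x₀ 0) * rotY E zs q)
      (a' := Dy (slice E zs 0 2)) (b' := Dy (slice E zs 1 2)) (zs - x₀ 2)
      (n1.add (c1.const_mul _)) (n2.add (c2.const_mul _)) (cd ha (0, 1)) (cd hb (0, 1))
    rw [h1, loop_dy_eq_zero hb hk, loop_const_mul] at h2
    have h3 : burgersVector E x₀ C 1 (toR2 p) = _ := Eq.trans (by
      rw [burgersVector, hC.1, hC.2, loopIntegral_circleLoop]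
      refine loop_congr fun t => ⟨?_, ?_⟩
      · rw [(burgersField_slice hopen hE 0 (hreg t)).2.1, hs]
        simp only [rotX]
        ring
      · rw [(burgersField_slice hopen hE 1 (hreg t)).2.1, hds]
        simp only [rotY]
        ring) h2
    rw [h3, momentX, frankJump]
    ring
  · rw [shearJump, ← loop_vertical_burgers ha hb hk (x₀ 0) (x₀ 1), burgersVector, hC.1, hC.2,
      loopIntegral_circleLoop]
    exact loop_congr fun t => ⟨(burgersField_slice hopen hE 0 (hreg t)).2.2,
      (burgersField_slice hopen hE 1 (hreg t)).2.2⟩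

end JumpVectors

/-! ### Test functions, their derivatives and their slices. -/

section TestFunctions

open Real Filter Topology

variable {Ω : Opens R3}

/-- The partial derivative of a test function. -/
def tpd (i : Fin 3) (φ : 𝓓(Ω, ℝ)) : 𝓓(Ω, ℝ) := LineDeriv.lineDerivOp (e i) φ

lemma tpd_apply (i : Fin 3) (φ : 𝓓(Ω, ℝ)) (x : R3) : tpd i φ x = pd i φ x := by
  have h : tpd i φ x = TestFunction.fderivCLM ℝ ⊤ ⊤ φ x (e i) := rfl
  rw [h, TestFunction.fderivCLM_apply_of_le φ (by simp), pd]

lemma dpd_apply (i : Fin 3) (T : 𝓓'(Ω, ℝ)) (φ : 𝓓(Ω, ℝ)) : dpd i T φ = -T (tpd i φ) := rfl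

lemma tsupport_tpd_subset (i : Fin 3) (φ : 𝓓(Ω, ℝ)) : tsupport (tpd i φ) ⊆ tsupport φ := by
  have h : ⇑(tpd i φ) = fun x => fderiv ℝ φ x (e i) := funext fun x => tpd_apply i φ x
  rw [h]
  exact tsupport_dd_subset _ _

lemma differentiable_test (φ : 𝓓(Ω, ℝ)) : Differentiable ℝ φ :=
  φ.contDiff.differentiable (by simp)

lemma dd_test (φ : 𝓓(Ω, ℝ)) (z : ℝ) :
    Dx (fun q => φ (pt q z)) = (fun q => tpd 0 φ (pt q z)) ∧
      Dy (fun q => φ (pt q z)) = (fun q => tpd 1 φ (pt q z)) :=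
  ⟨funext fun q => by rw [(dd_comp_pt (differentiable_test φ _)).1, tpd_apply],
    funext fun q => by rw [(dd_comp_pt (differentiable_test φ _)).2, tpd_apply]⟩

lemma tpd_comm (i j : Fin 3) (φ : 𝓓(Ω, ℝ)) : tpd i (tpd j φ) = tpd j (tpd i φ) := by
  have h : ∀ k, ⇑(tpd k φ) = pd k φ := fun k => funext fun x => tpd_apply k φ x
  ext x
  rw [tpd_apply, tpd_apply, h, h]
  exact dd_comm ((contDiff_infty.1 φ.contDiff 2).contDiffAt) (e i) (e j)

variable {p : ℝ × ℝ} {z₀ ρ : ℝ}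

lemma mem_box_of_ne_zero {f : R3 → ℝ} (hf : tsupport f ⊆ openCylinder p z₀ ρ) {q : ℝ × ℝ} {z : ℝ}
    (h : f (pt q z) ≠ 0) : q ∈ disc p ρ ∧ |z - z₀| ≤ ρ := by
  have := hf (subset_tsupport f h)
  exact ⟨this.1.le, this.2.le⟩

lemma contDiff_test_slice (φ : 𝓓(Ω, ℝ)) (z : ℝ) : ContDiff ℝ 2 fun q => φ (pt q z) :=
  (contDiff_infty.1 φ.contDiff 2).comp (contDiff_pt_left z)

lemma tsupport_test_slice {f : R3 → ℝ} (hf : tsupport f ⊆ openCylinder p z₀ ρ) (z : ℝ) :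
    tsupport (fun q => f (pt q z)) ⊆ disc p ρ :=
  closure_minimal (fun _ hq => (mem_box_of_ne_zero hf hq).1) (isClosed_disc p ρ)

end TestFunctions

/-! ### The strain as a distribution in a cylinder. -/

section CylinderIntegrals

open Real Filter Topology

variable {Ω : Opens R3} {P : Set R2} {C : Loops} {E : Fin 3 → Fin 3 → R3 → ℝ}
  {p : ℝ × ℝ} {z₀ zs r ρ : ℝ}

lemma IsCylinder.regular (hcyl : IsCylinder Ω P C p z₀ zs r ρ) {q : ℝ × ℝ} {z : ℝ}
    (hq : q ∈ disc p ρ) (hne : q ≠ p) (hz : |z - z₀| ≤ ρ) : pt q z ∈ regularPart Ω P := by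
  have hq' : q ∈ disc p r := by
    have h : (q.1 - p.1) ^ 2 + (q.2 - p.2) ^ 2 ≤ ρ ^ 2 := hq
    have h0 := hcyl.pos
    have h1 := hcyl.lt
    show (q.1 - p.1) ^ 2 + (q.2 - p.2) ^ 2 ≤ r ^ 2
    nlinarith
  exact ⟨hcyl.box q hq z hz, (hcyl.punctured q hq' hne).2⟩

lemma IsCylinder.strain_eq_slice (hcyl : IsCylinder Ω P C p z₀ zs r ρ) (hE : IsStrain Ω P E)
    (i j : Fin 3) {q : ℝ × ℝ} {z : ℝ} (hq : q ∈ disc p ρ) (hne : q ≠ p) (hz : |z - z₀| ≤ ρ) :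
    E i j (pt q z) = slice E zs i j q := by
  have hq' : q ∈ disc p r := by
    have h : (q.1 - p.1) ^ 2 + (q.2 - p.2) ^ 2 ≤ ρ ^ 2 := hq
    have h0 := hcyl.pos
    have h1 := hcyl.lt
    show (q.1 - p.1) ^ 2 + (q.2 - p.2) ^ 2 ≤ r ^ 2
    nlinarith
  exact hE.vertical i j _ (hcyl.regular hq hne hz) _ (hcyl.punctured q hq' hne) rfl

lemma ae_fst_ne (p : ℝ × ℝ) : ∀ᵐ w : (ℝ × ℝ) × ℝ, w.1 ≠ p := by
  have h : ∀ᵐ q : ℝ × ℝ, q ≠ p := by simp [ae_iff]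
  exact Measure.quasiMeasurePreserving_fst.ae h

/-- The action of a component of the strain on a test function supported in a cylinder. -/
lemma ofFun_apply_eq (hcyl : IsCylinder Ω P C p z₀ zs r ρ) (hE : IsStrain Ω P E) (i j : Fin 3)
    {φ : 𝓓(Ω, ℝ)} (hφ : tsupport φ ⊆ openCylinder p z₀ ρ) :
    Integrable (fun w : (ℝ × ℝ) × ℝ => φ (pt w.1 w.2) * slice E zs i j w.1) ∧
    ofFun Ω (E i j) φ = ∫ w : (ℝ × ℝ) × ℝ, φ (pt w.1 w.2) * slice E zs i j w.1 := by
  have hae : (fun w : (ℝ × ℝ) × ℝ => φ (pt w.1 w.2) * E i j (pt w.1 w.2)) =ᵐ[volume]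
      fun w => φ (pt w.1 w.2) * slice E zs i j w.1 := by
    -- The vertical line over `p` is null, and off it the strain inside the cylinder equals its
    -- slice at height `zs`.
    filter_upwards [ae_fst_ne p] with w hw
    by_cases h : φ (pt w.1 w.2) = 0
    · rw [h, zero_mul, zero_mul]
    · obtain ⟨h1, h2⟩ := mem_box_of_ne_zero hφ h
      rw [hcyl.strain_eq_slice hE i j h1 hw h2]
  have hint : Integrable (fun x => φ x * E i j x) :=
    φ.integrable_bilin (ContinuousLinearMap.mul ℝ ℝ) (hE.integrable i j)
  refine ⟨Integrable.congr (measurePreserving_ptEquiv.integrable_comp_of_integrable hint) hae, ?_⟩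
  rw [← integral_congr_ae hae, ← integral_eq_integral_pt fun x => φ x * E i j x]
  exact TestFunction.integralAgainstBilinCLM_eq_integral (hE.integrable i j)

lemma ofFun_symm (hcyl : IsCylinder Ω P C p z₀ zs r ρ) (hE : IsStrain Ω P E) (i j : Fin 3)
    {φ : 𝓓(Ω, ℝ)} (hφ : tsupport φ ⊆ openCylinder p z₀ ρ) :
    ofFun Ω (E i j) φ = ofFun Ω (E j i) φ := by
  rw [(ofFun_apply_eq hcyl hE i j hφ).2, (ofFun_apply_eq hcyl hE j i hφ).2]
  refine integral_congr_ae ?_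
  filter_upwards [ae_fst_ne p] with w hw
  by_cases h : φ (pt w.1 w.2) = 0
  · rw [h, zero_mul, zero_mul]
  · obtain ⟨h1, h2⟩ := mem_box_of_ne_zero hφ h
    rw [← hcyl.strain_eq_slice hE i j h1 hw h2, ← hcyl.strain_eq_slice hE j i h1 hw h2,
      hE.symm i j _ (hcyl.regular h1 hw h2)]

lemma isCompact_disc (p : ℝ × ℝ) (ρ : ℝ) : IsCompact (disc p ρ) := by
  refine Metric.isCompact_of_isClosed_isBounded (isClosed_disc p ρ)
    ((Metric.isBounded_closedBall (x := p) (r := |ρ|)).subset fun q hq => ?_)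
  have h : (q.1 - p.1) ^ 2 + (q.2 - p.2) ^ 2 ≤ ρ ^ 2 := hq
  rw [Metric.mem_closedBall, Prod.dist_eq, max_le_iff, dist_eq, dist_eq]
  exact ⟨sq_le_sq.1 (by nlinarith), sq_le_sq.1 (by nlinarith)⟩

/-- The slice at height `zs` may lie outside the cylinder, where local integrability of the strain
gives no direct control. By Fubini some slice inside the cylinder is integrable, and by independence
of `z` all these slices agree off `p`. -/
lemma integrableOn_slice (hcyl : IsCylinder Ω P C p z₀ zs r ρ) (hE : IsStrain Ω P E)
    (i j : Fin 3) : IntegrableOn (slice E zs i j) (disc p ρ) := by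
  have hρ := hcyl.pos
  set I := Set.Icc (z₀ - ρ) (z₀ + ρ)
  have hcont : Continuous fun w : (ℝ × ℝ) × ℝ => pt w.1 w.2 := (contDiff_pt (n := 0)).continuous
  have hz : ∀ z ∈ I, |z - z₀| ≤ ρ := fun z h => abs_le.2 ⟨by linarith [h.1], by linarith [h.2]⟩
  have hK : IsCompact (ptEquiv '' (disc p ρ ×ˢ I)) :=
    ((isCompact_disc p ρ).prod isCompact_Icc).image hcont
  have hKΩ : ptEquiv '' (disc p ρ ×ˢ I) ⊆ Ω := by
    rintro _ ⟨w, hw, rfl⟩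
    exact hcyl.box _ hw.1 _ (hz _ hw.2)
  have h1 := (hE.integrable i j).integrableOn_compact_subset hKΩ hK
  rw [← measurePreserving_ptEquiv.integrableOn_comp_preimage ptEquiv.measurableEmbedding,
    Set.preimage_image_eq _ ptEquiv.injective, IntegrableOn, Measure.volume_eq_prod,
    ← Measure.prod_restrict] at h1
  have h2 := h1.prod_left_ae
  have : NeBot (ae (volume.restrict I)) := by
    rw [ae_neBot, Ne, Measure.restrict_eq_zero, Real.volume_Icc]
    simp [hρ]
  obtain ⟨z, h3, h4⟩ := (h2.and (ae_restrict_mem measurableSet_Icc)).exists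
  refine h3.congr ?_
  have h5 : ∀ᵐ q : ℝ × ℝ, q ≠ p := by simp [ae_iff]
  filter_upwards [ae_restrict_of_ae h5, ae_restrict_mem (isClosed_disc p ρ).measurableSet]
    with q hne hq
  exact hcyl.strain_eq_slice hE i j hq hne (hz z h4)

end CylinderIntegrals

/-! ### Curl and incompatibility of the strain in a cylinder. -/

section Pairings

open Real Filter Topology

variable {Ω : Opens R3} {P : Set R2} {C : Loops} {E : Fin 3 → Fin 3 → R3 → ℝ}
  {p : ℝ × ℝ} {z₀ zs r ρ : ℝ} {φ : 𝓓(Ω, ℝ)}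

lemma tsupport_tpd_subset_of (i : Fin 3) {S : Set R3} (hφ : tsupport φ ⊆ S) :
    tsupport (tpd i φ) ⊆ S :=
  (tsupport_tpd_subset i φ).trans hφ

lemma integrable_vertical (hφ : tsupport φ ⊆ openCylinder p z₀ ρ) (q : ℝ × ℝ) :
    Integrable fun z => φ (pt q z) := by
  have hc : Continuous fun z => φ (pt q z) :=
    φ.continuous.comp ((contDiff_pt (n := 0)).continuous.comp (Continuous.prodMk_right q))
  refine hc.integrable_of_hasCompactSupport
    (HasCompactSupport.intro (isCompact_Icc (a := z₀ - ρ) (b := z₀ + ρ)) fun z hz => ?_)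
  by_contra h
  have := abs_le.1 (mem_box_of_ne_zero hφ h).2
  exact hz ⟨by linarith, by linarith⟩

lemma integral_tpd_two (hφ : tsupport φ ⊆ openCylinder p z₀ ρ) (q : ℝ × ℝ) :
    ∫ z, tpd 2 φ (pt q z) = 0 := by
  refine integral_eq_zero_of_hasDerivAt_of_integrable (f := fun z => φ (pt q z)) (fun z => ?_)
    (integrable_vertical (tsupport_tpd_subset_of 2 hφ) q) (integrable_vertical hφ q)
  rw [tpd_apply]
  exact hasDerivAt_comp_pt (differentiable_test φ _)

/-- Along each vertical the slice is constant and the derivative of a compactly supported function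
integrates to zero. Thus `∂_z E = 0` across the line too, not only on the regular part. -/
lemma ofFun_tpd_two (hcyl : IsCylinder Ω P C p z₀ zs r ρ) (hE : IsStrain Ω P E) (i j : Fin 3)
    (hφ : tsupport φ ⊆ openCylinder p z₀ ρ) : ofFun Ω (E i j) (tpd 2 φ) = 0 := by
  obtain ⟨h1, h2⟩ := ofFun_apply_eq hcyl hE i j (tsupport_tpd_subset_of 2 hφ)
  rw [h2, Measure.volume_eq_prod, integral_prod _ h1]
  simp_rw [integral_mul_const, integral_tpd_two hφ, zero_mul, integral_zero]

lemma integrable_mul_test {g : R3 → ℝ} (hg : Continuous g) (φ : 𝓓(Ω, ℝ)) :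
    Integrable fun x => g x * φ x :=
  (hg.mul φ.continuous).integrable_of_hasCompactSupport φ.hasCompactSupport.mul_left

lemma integral_affine_mul_tpd (i : Fin 3) (c : ℝ) (φ : 𝓓(Ω, ℝ)) :
    ∫ x : R3, (x i - c) * tpd i φ x = -∫ x, φ x := by
  have hd : ∀ x, HasFDerivAt (fun x : R3 => x i - c) (EuclideanSpace.proj i : R3 →L[ℝ] ℝ) x :=
    fun x => (EuclideanSpace.proj i : R3 →L[ℝ] ℝ).hasFDerivAt.sub_const c
  have h1 : ∀ x, fderiv ℝ (fun x : R3 => x i - c) x (e i) = 1 := fun x => by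
    rw [(hd x).fderiv]; simp [e]
  have h2 : ∀ x, tpd i φ x = fderiv ℝ φ x (e i) := fun x => tpd_apply i φ x
  have hc : Continuous fun x : R3 => x i - c := by fun_prop
  have := integral_mul_fderiv_eq_neg_fderiv_mul_of_integrable (μ := (volume : Measure R3))
    (f := fun x : R3 => x i - c) (g := φ) (v := e i)
    (by simp only [h1]; exact integrable_mul_test continuous_const φ)
    (by simp only [← h2]; exact integrable_mul_test hc (tpd i φ)) (integrable_mul_test hc φ)
    (fun x _ => (hd x).differentiableAt) (fun x _ => differentiable_test φ x)
  simpa only [h1, one_mul, ← h2] using this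

lemma integral_tpd (i : Fin 3) (φ : 𝓓(Ω, ℝ)) : ∫ x : R3, tpd i φ x = 0 := by
  have h0 := integral_affine_mul_tpd i 0 φ
  have h1 := integral_affine_mul_tpd i 1 φ
  have hint : ∀ c : ℝ, Integrable fun x : R3 => (x i - c) * tpd i φ x := fun c =>
    integrable_mul_test (by fun_prop) _
  have h2 := integral_sub (hint 0) (hint 1)
  rw [h0, h1, sub_self] at h2
  rw [← h2]
  congr with x
  ring

lemma IsCylinder.regular_circ (hcyl : IsCylinder Ω P C p z₀ zs r ρ) (t : ℝ) :
    pt (circ p r t) zs ∈ regularPart Ω P := by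
  have hr : 0 < r := hcyl.pos.trans hcyl.lt
  refine hcyl.punctured _ (circ_mem_disc p hr.le le_rfl t) fun h => ?_
  have h1 : p.1 + r * cos t = p.1 := congrArg Prod.fst h
  have h2 : p.2 + r * sin t = p.2 := congrArg Prod.snd h
  have h3 : cos t = 0 := by simpa [hr.ne'] using h1
  have h4 : sin t = 0 := by simpa [hr.ne'] using h2
  have := cos_sq_add_sin_sq t
  rw [h3, h4] at this
  norm_num at this

/-- The curl of the vertical shear is its regular value plus the jump on the line. -/
lemma ofFun_curl (hopen : IsOpen (regularPart Ω P)) (hcyl : IsCylinder Ω P C p z₀ zs r ρ)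
    (hE : IsStrain Ω P E) {K : ℝ}
    (hK : ∀ x ∈ regularPart Ω P,
      ∑ α : Fin 2, ∑ β : Fin 2, eps2 α β * pd (lat α) (E (lat β) 2) x = K)
    (hφ : tsupport φ ⊆ openCylinder p z₀ ρ) :
    ofFun Ω (E 0 2) (tpd 1 φ) - ofFun Ω (E 1 2) (tpd 0 φ) =
      K * (∫ x, φ x) + shearJump E zs p r K * ∫ z, φ (pt p z) := by
  obtain ⟨i1, e1⟩ := ofFun_apply_eq hcyl hE 0 2 (tsupport_tpd_subset_of 1 hφ)
  obtain ⟨i2, e2⟩ := ofFun_apply_eq hcyl hE 1 2 (tsupport_tpd_subset_of 0 hφ)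
  -- Subtracting `K (x - p.1)` from `E_{yz}` makes the form closed off `p`, as `integral_curl`
  -- demands; integrated by parts, this correction gives back `K ∫ φ`.
  have i3 : Integrable fun w : (ℝ × ℝ) × ℝ => K * ((w.1.1 - p.1) * tpd 0 φ (pt w.1 w.2)) :=
    (measurePreserving_ptEquiv.integrable_comp_of_integrable
      (integrable_mul_test (by fun_prop : Continuous fun x : R3 => x 0 - p.1) (tpd 0 φ))).const_mul K
  have e3 : ∫ w : (ℝ × ℝ) × ℝ, K * ((w.1.1 - p.1) * tpd 0 φ (pt w.1 w.2)) = -(K * ∫ x, φ x) := by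
    rw [integral_const_mul, ← mul_neg, ← integral_affine_mul_tpd 0 p.1 φ,
      integral_eq_integral_pt fun x => (x 0 - p.1) * tpd 0 φ x]
    rfl
  have key : ∀ z, ∫ q : ℝ × ℝ, (tpd 1 φ (pt q z) * slice E zs 0 2 q -
      tpd 0 φ (pt q z) * slice E zs 1 2 q + K * ((q.1 - p.1) * tpd 0 φ (pt q z))) =
      φ (pt p z) * shearJump E zs p r K := by
    intro z
    have hρd : IntegrableOn (fun q : ℝ × ℝ => K * (q.1 - p.1)) (disc p ρ) :=
      (by fun_prop : Continuous fun q : ℝ × ℝ => K * (q.1 - p.1)).continuousOn.integrableOn_compact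
        (isCompact_disc p ρ)
    have := integral_curl (a := slice E zs 0 2) (b := fun q => slice E zs 1 2 q - K * (q.1 - p.1))
      hcyl.pos hcyl.lt (fun q hq hne => by
        have hreg := hcyl.punctured q hq hne
        have h2 := (contDiffAt_slice hopen hE 1 2 hreg).of_le (m := 1) (by norm_num)
        have h3 : ContDiffAt ℝ 1 (fun q : ℝ × ℝ => K * (q.1 - p.1)) q := by fun_prop
        refine ⟨(contDiffAt_slice hopen hE 0 2 hreg).of_le (by norm_num), h2.sub h3, ?_⟩
        have dx : Dx (fun q : ℝ × ℝ => q.1 - p.1) q = 1 := by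
          rw [dd, ((hasFDerivAt_coord q).1.sub_const p.1).fderiv]; rfl
        rw [dd_sub (h2.differentiableAt (by norm_num)) (h3.differentiableAt (by norm_num)),
          dd_const_mul _ _ (by fun_prop), dx, ← curl_slice hopen hE hK hreg]
        ring) (integrableOn_slice hcyl hE 0 2) ((integrableOn_slice hcyl hE 1 2).sub hρd)
      (contDiff_test_slice φ z) (tsupport_test_slice hφ z)
    rw [(dd_test φ z).1, (dd_test φ z).2] at this
    rw [shearJump, ← this]
    congr with q
    ring
  have tot := ((i1.sub i2).add i3)
  have h := integral_prod_symm _ tot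
  simp only [Pi.add_apply, Pi.sub_apply] at h
  simp_rw [key, integral_mul_const] at h
  rw [← Measure.volume_eq_prod] at h
  have h' := integral_add (i1.sub i2) i3
  simp only [Pi.sub_apply] at h'
  rw [h', integral_sub i1 i2, e3, ← e1, ← e2] at h
  linarith

/-- The incompatibility of the planar strain is concentrated on the line. -/
lemma ofFun_incompatibility (hopen : IsOpen (regularPart Ω P))
    (hcyl : IsCylinder Ω P C p z₀ zs r ρ) (hE : IsStrain Ω P E)
    (hφ : tsupport φ ⊆ openCylinder p z₀ ρ) :
    ofFun Ω (E 1 1) (tpd 0 (tpd 0 φ)) - 2 * ofFun Ω (E 0 1) (tpd 0 (tpd 1 φ)) +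
      ofFun Ω (E 0 0) (tpd 1 (tpd 1 φ)) =
      frankJump E zs p r * (∫ z, φ (pt p z)) + momentX E zs p r * (∫ z, tpd 0 φ (pt p z)) +
        momentY E zs p r * ∫ z, tpd 1 φ (pt p z) := by
  have s := fun i j => tsupport_tpd_subset_of i (tsupport_tpd_subset_of j hφ)
  obtain ⟨i1, e1⟩ := ofFun_apply_eq hcyl hE 1 1 (s 0 0)
  obtain ⟨i2, e2⟩ := ofFun_apply_eq hcyl hE 0 1 (s 0 1)
  obtain ⟨i3, e3⟩ := ofFun_apply_eq hcyl hE 0 0 (s 1 1)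
  have key : ∀ z, ∫ q : ℝ × ℝ, (tpd 0 (tpd 0 φ) (pt q z) * slice E zs 1 1 q -
      2 * (tpd 0 (tpd 1 φ) (pt q z) * slice E zs 0 1 q) +
      tpd 1 (tpd 1 φ) (pt q z) * slice E zs 0 0 q) =
      φ (pt p z) * frankJump E zs p r + tpd 0 φ (pt p z) * momentX E zs p r +
        tpd 1 φ (pt p z) * momentY E zs p r := by
    intro z
    have := integral_incompatibility (A := slice E zs 0 0) (B := slice E zs 0 1)
      (D := slice E zs 1 1) hcyl.pos hcyl.lt
      (fun q hq hne => compatibleAt_slice hopen hE (hcyl.punctured q hq hne))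
      (integrableOn_slice hcyl hE 0 0) (integrableOn_slice hcyl hE 0 1)
      (integrableOn_slice hcyl hE 1 1) (contDiff_test_slice φ z) (tsupport_test_slice hφ z)
    rw [loop_affinePart hopen hE hcyl.regular_circ,
      (dd_test φ z).1, (dd_test φ z).2, (dd_test (tpd 0 φ) z).1,
      (dd_test (tpd 1 φ) z).1, (dd_test (tpd 1 φ) z).2] at this
    rw [← this]
    congr with q
    ring
  have tot := ((i1.sub (i2.const_mul 2)).add i3)
  have h := integral_prod_symm _ tot
  simp only [Pi.add_apply, Pi.sub_apply] at h
  simp_rw [key] at h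
  have j := fun (ψ : 𝓓(Ω, ℝ)) (hψ : tsupport ψ ⊆ openCylinder p z₀ ρ) (c : ℝ) =>
    (integrable_vertical hψ p).mul_const c
  have j0 := j φ hφ (frankJump E zs p r)
  have j1 := j _ (tsupport_tpd_subset_of 0 hφ) (momentX E zs p r)
  have j2 := j _ (tsupport_tpd_subset_of 1 hφ) (momentY E zs p r)
  rw [integral_add (f := fun z => φ (pt p z) * frankJump E zs p r +
      tpd 0 φ (pt p z) * momentX E zs p r) (j0.add j1) j2, integral_add j0 j1,
    integral_mul_const, integral_mul_const, integral_mul_const] at h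
  rw [← Measure.volume_eq_prod] at h
  have h' := integral_add (i1.sub (i2.const_mul 2)) i3
  simp only [Pi.sub_apply] at h'
  rw [h', integral_sub i1 (i2.const_mul 2), integral_const_mul, ← e1, ← e2, ← e3] at h
  linarith

end Pairings

/-! ### Hausdorff measure on the lines. -/

section LineMeasures

open Real Filter Topology

variable {Ω : Opens R3} {P : Set R2} {C : Loops} {p : ℝ × ℝ} {z₀ zs r ρ : ℝ}

lemma isometry_pt (p : ℝ × ℝ) : Isometry (pt p) := by
  refine Isometry.of_dist_eq fun z z' => ?_
  rw [EuclideanSpace.dist_eq, Fin.sum_univ_three]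
  simp [dist_eq, sqrt_sq_eq_abs]

lemma continuous_pt (p : ℝ × ℝ) : Continuous (pt p) := (isometry_pt p).continuous

lemma IsCylinder.planar_eq (hcyl : IsCylinder Ω P C p z₀ zs r ρ) {x : R3}
    (hx : x ∈ openCylinder p z₀ ρ) (hP : planar x ∈ P) : (x 0, x 1) = p := by
  by_contra hne
  have h := (hcyl.regular (q := (x 0, x 1)) (z := x 2) hx.1.le hne hx.2.le).2
  rw [pt_eta] at h
  exact h hP

/-- The line over `p` is the only one in the cylinder, and its parametrization by height is an
isometry, which carries one-dimensional Hausdorff measure, that is Lebesgue measure on `ℝ`, to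
Hausdorff measure on the line. -/
lemma restrict_lines_of_mem (hcyl : IsCylinder Ω P C p z₀ zs r ρ) (hP : toR2 p ∈ P) :
    ((Measure.hausdorffMeasure 1 : Measure R3).restrict (lines P)).restrict (openCylinder p z₀ ρ) =
      (volume.restrict (pt p ⁻¹' openCylinder p z₀ ρ)).map (pt p) := by
  have hV := (isOpen_openCylinder p z₀ ρ).measurableSet
  rw [← Measure.restrict_map (continuous_pt p).measurable hV, ← hausdorffMeasure_real,
    (isometry_pt p).map_hausdorffMeasure (Or.inl zero_le_one), Measure.restrict_restrict hV,
    Measure.restrict_restrict hV]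
  congr 1
  ext x
  refine and_congr_right fun hx => ⟨fun h => ⟨x 2, ?_⟩, ?_⟩
  · rw [← hcyl.planar_eq hx h, pt_eta]
  · rintro ⟨z, rfl⟩
    exact hP

lemma restrict_lines_of_notMem (hcyl : IsCylinder Ω P C p z₀ zs r ρ) (hP : toR2 p ∉ P) :
    ((Measure.hausdorffMeasure 1 : Measure R3).restrict (lines P)).restrict (openCylinder p z₀ ρ) =
      0 := by
  rw [Measure.restrict_restrict (isOpen_openCylinder p z₀ ρ).measurableSet]
  have : openCylinder p z₀ ρ ∩ lines P = ∅ := by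
    ext x
    refine ⟨fun h => hP ?_, fun h => h.elim⟩
    rw [← hcyl.planar_eq h.1 h.2]
    exact h.2
  rw [this, Measure.restrict_empty]

/-- Near each point the density is a constant on a segment of finite length, or there is no line at
all. This is the condition under which the distribution of the density is evaluated as an integral.
-/
lemma locallyIntegrableOn_lines (hopen : IsOpen (regularPart Ω P))
    (hC : ∀ p ∈ P, Encircles Ω P p (C.height p) (C.radius p)) (c : R2 → ℝ) :
    LocallyIntegrableOn (fun x => c (planar x)) Ω
      ((Measure.hausdorffMeasure 1 : Measure R3).restrict (lines P)) := by
  intro x hx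
  obtain ⟨p, z₀, zs, r, ρ, hcyl, hxV⟩ := exists_isCylinder hopen hC hx
  refine ⟨openCylinder p z₀ ρ,
    mem_nhdsWithin_of_mem_nhds ((isOpen_openCylinder p z₀ ρ).mem_nhds hxV), ?_⟩
  by_cases hP : toR2 p ∈ P
  · rw [IntegrableOn, restrict_lines_of_mem hcyl hP,
      (isometry_pt p).isClosedEmbedding.measurableEmbedding.integrable_map_iff]
    have hsub : pt p ⁻¹' openCylinder p z₀ ρ ⊆ Set.Icc (z₀ - ρ) (z₀ + ρ) := fun z hz => by
      have := abs_lt.1 hz.2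
      exact ⟨by linarith [this.1, pt_two p z], by linarith [this.2, pt_two p z]⟩
    exact (integrableOn_const (C := c (toR2 p)) isCompact_Icc.measure_lt_top.ne).mono_set hsub
  · rw [IntegrableOn, restrict_lines_of_notMem hcyl hP]
    exact integrable_zero_measure

open Classical in
/-- The action of a density on the lines on a test function supported in a cylinder. -/
lemma onLines_apply (hopen : IsOpen (regularPart Ω P))
    (hC : ∀ p ∈ P, Encircles Ω P p (C.height p) (C.radius p))
    (hcyl : IsCylinder Ω P C p z₀ zs r ρ) (c : R2 → ℝ) {φ : 𝓓(Ω, ℝ)}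
    (hφ : tsupport φ ⊆ openCylinder p z₀ ρ) :
    onLines Ω P (fun x => c (planar x)) φ =
      if toR2 p ∈ P then c (toR2 p) * ∫ z, φ (pt p z) else 0 := by
  have h0 : ∀ x ∉ openCylinder p z₀ ρ, φ x = 0 := fun x hx =>
    image_eq_zero_of_notMem_tsupport fun h => hx (hφ h)
  have h1 : onLines Ω P (fun x => c (planar x)) φ = ∫ x, φ x * c (planar x)
      ∂((Measure.hausdorffMeasure 1 : Measure R3).restrict (lines P)) :=
    TestFunction.integralAgainstBilinCLM_eq_integral (locallyIntegrableOn_lines hopen hC c)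
  rw [h1, ← setIntegral_eq_integral_of_forall_compl_eq_zero (s := openCylinder p z₀ ρ)
    fun x hx => by rw [h0 x hx, zero_mul]]
  split_ifs with hP
  · rw [restrict_lines_of_mem hcyl hP,
      (isometry_pt p).isClosedEmbedding.measurableEmbedding.integral_map,
      setIntegral_eq_integral_of_forall_compl_eq_zero fun z hz => by rw [h0 _ hz, zero_mul]]
    simp only [planar_pt, integral_mul_const]
    ring
  · rw [restrict_lines_of_notMem hcyl hP, integral_zero_measure]

end LineMeasures

/-! ### Locality of distributions. -/

section Locality

open Filter Topology
open scoped Manifold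

variable {Ω : Opens R3}

/-- A distribution that vanishes near every point vanishes. -/
lemma distribution_eq_zero_of_local {T : 𝓓'(Ω, ℝ)}
    (hT : ∀ x ∈ Ω, ∃ V : Set R3, IsOpen V ∧ x ∈ V ∧
      ∀ φ : 𝓓(Ω, ℝ), tsupport φ ⊆ V → T φ = 0) : T = 0 := by
  ext φ
  choose! V hV hxV hTV using hT
  have hφΩ := φ.tsupport_subset
  obtain ⟨t, ht, hcover⟩ := φ.hasCompactSupport.isCompact.elim_nhds_subcover V
    fun x hx => (hV x (hφΩ hx)).mem_nhds (hxV x (hφΩ hx))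
  -- A partition of unity on the compact support of `φ`, subordinate to finitely many of the given
  -- neighbourhoods, cuts `φ` into finitely many test functions, each annihilated by `T`.
  obtain ⟨f, hf⟩ := SmoothPartitionOfUnity.exists_isSubordinate 𝓘(ℝ, R3)
    (isClosed_tsupport φ) (fun x : t => V x) (fun x => hV x (hφΩ (ht x x.2)))
    (by rwa [Set.iUnion_subtype fun x => x ∈ t])
  have hsupp : ∀ i, tsupport (fun x => f i x * φ x) ⊆ tsupport (f i) ∩ tsupport φ := fun i =>
    Set.subset_inter (closure_mono (Function.support_mul_subset_left (f i) φ))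
      (closure_mono (Function.support_mul_subset_right (f i) φ))
  let ψ : t → 𝓓(Ω, ℝ) := fun i =>
    ⟨fun x => f i x * φ x, (f i).contMDiff.contDiff.mul φ.contDiff,
      φ.hasCompactSupport.mul_left, ((hsupp i).trans Set.inter_subset_right).trans hφΩ⟩
  have hφ : φ = ∑ i, ψ i := by
    ext x
    have h1 : (∑ i, ψ i) x = ∑ i, f i x * φ x := by
      have : ∀ s : Finset t, (∑ i ∈ s, ψ i) x = ∑ i ∈ s, f i x * φ x := by
        intro s
        induction s using Finset.induction_on with
        | empty => rfl
        | insert a s ha ih => rw [Finset.sum_insert ha, Finset.sum_insert ha, ← ih]; rfl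
      exact this _
    rw [h1, ← Finset.sum_mul]
    by_cases hx : x ∈ tsupport φ
    · rw [← finsum_eq_sum_of_fintype, f.sum_eq_one hx, one_mul]
    · rw [image_eq_zero_of_notMem_tsupport hx, mul_zero]
  rw [hφ, map_sum]
  exact Finset.sum_eq_zero fun i _ => hTV i (hφΩ (ht i i.2)) _
    (((hsupp i).trans Set.inter_subset_left).trans (hf i))

end Locality

/-! ### The two identities in a cylinder. -/

section LocalIdentities

open Real Filter Topology

variable {Ω : Opens R3} {P : Set R2} {C : Loops} {E : Fin 3 → Fin 3 → R3 → ℝ} {x₀ : R3}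
  {p : ℝ × ℝ} {z₀ zs r ρ : ℝ} {φ : 𝓓(Ω, ℝ)}

lemma dist_add_apply (S T : 𝓓'(Ω, ℝ)) (φ : 𝓓(Ω, ℝ)) : (S + T) φ = S φ + T φ := rfl

lemma dist_sub_apply (S T : 𝓓'(Ω, ℝ)) (φ : 𝓓(Ω, ℝ)) : (S - T) φ = S φ - T φ := rfl

lemma dist_smul_apply (c : ℝ) (T : 𝓓'(Ω, ℝ)) (φ : 𝓓(Ω, ℝ)) : (c • T) φ = c * T φ := rfl

lemma planar_apply (x : R3) (β : Fin 2) : planar x β = x (lat β) := by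
  fin_cases β <;> rfl

/-- The concentrated densities on a test function supported in a cylinder. -/
lemma densities_apply (hopen : IsOpen (regularPart Ω P))
    (hC : ∀ p ∈ P, Encircles Ω P p (C.height p) (C.radius p)) (hE : IsStrain Ω P E)
    (hcyl : IsCylinder Ω P C p z₀ zs r ρ) {K : ℝ}
    (hK : ∀ x ∈ regularPart Ω P,
      ∑ α : Fin 2, ∑ β : Fin 2, eps2 α β * pd (lat α) (E (lat β) 2) x = K)
    (hφ : tsupport φ ⊆ openCylinder p z₀ ρ) :
    (∀ k, disclinationDensity Ω P E C k φ = kron k 2 * frankJump E zs p r * ∫ z, φ (pt p z)) ∧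
    jumpDensity Ω P E x₀ C 0 φ = momentY E zs p r * (∫ z, φ (pt p z)) ∧
    jumpDensity Ω P E x₀ C 1 φ = -momentX E zs p r * (∫ z, φ (pt p z)) ∧
    jumpDensity Ω P E x₀ C 2 φ = 2 * shearJump E zs p r K * ∫ z, φ (pt p z) := by
  have hΘ := fun k => onLines_apply hopen hC hcyl (fun v => kron k 2 * frankVector E C 2 v) hφ
  have hΛ := fun k => onLines_apply hopen hC hcyl (fun v => burgersVector E x₀ C k v) hφ
  have hm := fun β : Fin 2 => onLines_apply hopen hC hcyl
    (fun v => frankVector E C 2 v * (v β - x₀ (lat β))) hφ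
  simp only [planar_apply] at hm
  have hp0 : toR2 p 0 = p.1 := rfl
  have hp1 : toR2 p 1 = p.2 := rfl
  simp only [disclinationDensity, jumpDensity, dislocationDensity, Fin.sum_univ_two,
    dist_sub_apply, dist_add_apply, dist_smul_apply, hΘ, hΛ, hm]
  by_cases hP : toR2 p ∈ P
  · have hF := frankVector_eq hopen hE hcyl.regular_circ (hcyl.loop_eq hP)
    obtain ⟨h0, h1, h2⟩ := burgersVector_eq (x₀ := x₀) hopen hE hK hcyl.regular_circ
      (hcyl.loop_eq hP)
    rw [← h0, ← h1, ← h2]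
    simp only [if_pos hP, hF, hp0, hp1]
    refine ⟨fun k => trivial, ?_, ?_, ?_⟩ <;> (simp [kron, eps2, eps3, lat]; try ring)
  -- If no line passes through `p`, the densities vanish in the cylinder, and the jumps around `p`
  -- vanish as well because the strain is regular on the whole disc.
  · have hr : 0 < r := hcyl.pos.trans hcyl.lt
    obtain ⟨h0, h1, h2, h3⟩ := jumps_eq_zero hopen hE hK hr.le fun q hq => by
      by_cases hq' : q = p
      · rw [hq']
        exact hcyl.center hP
      · exact hcyl.punctured q hq hq'
    simp only [if_neg hP, h0, h1, h2, h3]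
    simp

lemma contortion_apply (i j : Fin 3) : contortion Ω P E x₀ C i j φ =
    kron i 2 * jumpDensity Ω P E x₀ C j φ - 1 / 2 * kron i j * jumpDensity Ω P E x₀ C 2 φ := rfl

/-- Symmetry and the vanishing of `∂_z` hold for the strain as a distribution, so the formulas of
the regular part persist across the line. -/
lemma frankTensor_apply (hcyl : IsCylinder Ω P C p z₀ zs r ρ) (hE : IsStrain Ω P E)
    (hφ : tsupport φ ⊆ openCylinder p z₀ ρ) (m : Fin 3) :
    frankTensor Ω E m 0 φ = -ofFun Ω (E m 2) (tpd 1 φ) ∧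
    frankTensor Ω E m 1 φ = ofFun Ω (E m 2) (tpd 0 φ) ∧
    frankTensor Ω E m 2 φ = ofFun Ω (E m 0) (tpd 1 φ) - ofFun Ω (E m 1) (tpd 0 φ) := by
  have hs := fun i k => ofFun_symm hcyl hE i m (tsupport_tpd_subset_of k hφ)
  have h2 := fun i => ofFun_tpd_two hcyl hE i m hφ
  refine ⟨?_, ?_, ?_⟩ <;>
  · simp only [frankTensor, Fin.sum_univ_three, dist_add_apply, dist_smul_apply, dpd_apply, ← hs, h2]
    simp [eps3]
    try ring

/-- For `k = x, y` the left side is a planar derivative, up to sign, of the curl of the shear minus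
`α_z / 2`, that is of the constant `K`. For `k = z` it is the incompatibility of the planar strain
minus `ε_{αβ} ∂_α α_β`: the moments cancel and only the Frank jump is left. -/
lemma incompatibility_apply (hopen : IsOpen (regularPart Ω P))
    (hC : ∀ p ∈ P, Encircles Ω P p (C.height p) (C.radius p)) (hE : IsStrain Ω P E)
    (hcyl : IsCylinder Ω P C p z₀ zs r ρ) (hφ : tsupport φ ⊆ openCylinder p z₀ ρ) (k : Fin 3) :
    (∑ α : Fin 2, ∑ β : Fin 2, eps2 α β • dpd (lat α) (ethRotation Ω P E x₀ C β k)) φ =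
      disclinationDensity Ω P E C k φ := by
  obtain ⟨K, a, b, hcomp⟩ := hE.compatible
  have hK := fun x hx => (hcomp x hx).2.1
  have hφ' := fun i => tsupport_tpd_subset_of i hφ
  have D := fun i => (densities_apply (x₀ := x₀) hopen hC hE hcyl hK (hφ' i)).2
  rw [(densities_apply (x₀ := x₀) hopen hC hE hcyl hK hφ).1 k]
  have F := fun i m => frankTensor_apply hcyl hE (hφ' i) m
  have curl := fun i => ofFun_curl hopen hcyl hE hK (hφ' i)
  have inc := ofFun_incompatibility hopen hcyl hE hφ
  have hl0 : lat 0 = 0 := rfl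
  have hl1 : lat 1 = 1 := rfl
  have hs := ofFun_symm hcyl hE 1 0 (tsupport_tpd_subset_of 1 (hφ' 0))
  -- The curl formula is applied to derivatives of `φ`, whose integral is zero, so the constant `K`
  -- drops out.
  simp only [integral_tpd, mul_zero, zero_add] at curl
  simp only [Fin.sum_univ_two, dist_add_apply, dist_smul_apply, dpd_apply, ethRotation,
    dist_sub_apply, contortion_apply, hl0, hl1]
  have hc := tpd_comm 0 1 φ
  fin_cases k
  · simp [eps2, eps3, lat, kron, F, D]
    have := curl 1
    rw [hc] at this
    linarith
  · simp [eps2, eps3, lat, kron, F, D]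
    have := curl 0
    rw [← hc] at this
    linarith
  · simp [eps2, eps3, lat, kron, F, D]
    rw [hc] at inc ⊢
    linarith

/-- Pure algebra of the permutation symbols. The curl of the strain cancels against the contracted
Frank tensor. For `k = z` the contraction takes the planar trace `κ_{xx} + κ_{yy} = -α_z`; for
planar `k` it selects `κ_{zk} = α_k`. -/
lemma displacement_apply (hE : IsStrain Ω P E)
    (hcyl : IsCylinder Ω P C p z₀ zs r ρ) (hφ : tsupport φ ⊆ openCylinder p z₀ ρ) (k : Fin 3) :
    (∑ α : Fin 2, ∑ β : Fin 2, eps2 α β • ethEthDisplacement Ω P E x₀ C α β k) φ =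
      jumpDensity Ω P E x₀ C k φ := by
  have F := fun m => frankTensor_apply hcyl hE hφ m
  have hl0 : lat 0 = 0 := rfl
  have hl1 : lat 1 = 1 := rfl
  have hs := fun k => ofFun_symm hcyl hE 1 0 (tsupport_tpd_subset_of k hφ)
  have hs2 := fun i k => ofFun_symm hcyl hE 2 i (tsupport_tpd_subset_of k hφ)
  simp only [Fin.sum_univ_two, Fin.sum_univ_three, dist_add_apply, dist_smul_apply, dpd_apply,
    ethEthDisplacement, ethRotation, dist_sub_apply, contortion_apply, hl0, hl1]
  fin_cases k
  · simp [eps2, eps3, lat, kron, F, hs]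
    ring
  · simp [eps2, eps3, lat, kron, F, hs]
    ring
  · simp [eps2, eps3, lat, kron, F, hs2]
    ring

end LocalIdentities

end Dislocation

end

/-! ### From cylinders to the whole domain. -/

open Dislocation in
theorem mainTheorem4
    (Ω : TopologicalSpace.Opens R3)
    (P : Set R2)
    (hopen : IsOpen (regularPart Ω P))
    (C : Loops)
    (hC : ∀ p ∈ P, Encircles Ω P p (C.height p) (C.radius p))
    (E : Fin 3 → Fin 3 → R3 → ℝ)
    (hE : IsStrain Ω P E)
    (x₀ : R3) :
    (∀ k : Fin 3,
      ∑ α : Fin 2, ∑ β : Fin 2,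
        eps2 α β • dpd (lat α) (ethRotation Ω P E x₀ C β k)
        = disclinationDensity Ω P E C k) ∧
    (∀ k : Fin 3,
      ∑ α : Fin 2, ∑ β : Fin 2,
        eps2 α β • ethEthDisplacement Ω P E x₀ C α β k
        = jumpDensity Ω P E x₀ C k) := by
  refine ⟨fun k => sub_eq_zero.1 (distribution_eq_zero_of_local fun x hx => ?_),
    fun k => sub_eq_zero.1 (distribution_eq_zero_of_local fun x hx => ?_)⟩
  all_goals
    obtain ⟨p, z₀, zs, r, ρ, hcyl, hxV⟩ := exists_isCylinder hopen hC hx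
    refine ⟨openCylinder p z₀ ρ, isOpen_openCylinder p z₀ ρ, hxV, fun φ hφ => ?_⟩
    rw [dist_sub_apply, sub_eq_zero]
  · exact incompatibility_apply hopen hC hE hcyl hφ k
  · exact displacement_apply hE hcyl hφ k
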